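/- \textbf{Setting.} Let $X$ be a set of $n$ items from a linearly ordered universe, let $T_1,T_2$ be two tables with $m$ cells each, and let $h_1,h_2$ be independent, completely random hash functions from the universe to the $m$ cells of $T_1$ and of $T_2$. For a constant $\varepsilon\in(0,1)$ assume $n\le(1-\varepsilon)m$. The \emph{cuckoo graph} is the bipartite multigraph with vertex sets $\{h_1(x):x\in X\}$ and $\{h_2(x):x\in X\}$ and with one edge $(h_1(x),h_2(x))$ for each $x\in X$, parallel edges allowed. Its vertices are numbered by their cells, with the cells of $T_1$ before those of $T_2$. A \emph{MapReduce computation} repeats phases of three steps. In the map step each value $x$ is mapped to a key-value pair. The shuffle step collects, for each key $k$, the list of all values with key $k$. The reduce step produces from each such list some non-final values (the input of the next phase) and some final values (output). The \emph{message complexity} is the sum over all phases of the total size of the inputs and outputs of the map, shuffle and reduce steps, each value having constant size. \textbf{The MapReduce BFS algorithm} for cuckoo hashing starts from the $n$ edges of the cuckoo graph. After two phases that create the vertices, it runs, in synchronous iterations (one phase each), a breadth-first search from every vertex simultaneously. Each vertex keeps the root (``component'') of the search it belongs to, initially itself, its parent, and the flags active, pending, complete, finished; in each iteration it sends this record along all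 of its edges. \begin{itemize} \item Initially all vertices are active. If the smallest component $d$ of an active neighbor of $w$ is smaller than the component of $w$, then $w$ discards its earlier work, joins the search $d$ as a child of the smallest-numbered such neighbor (through the smallest parallel edge), and becomes active. Otherwise an active vertex becomes pending. \item A pending vertex becomes complete when all of its neighbors belong to the same search as it does and all of its children are complete. \item A complete vertex becomes finished if it is a root or its parent is finished. \item A finished vertex whose children are all finished (or already final) is final: it outputs its root, its parent and the item stored in its cell, and marks its remaining edges as tree or non-tree edges. It is not processed any more, and messages to it are dropped. \end{itemize} A non-root vertex stores the item of the edge to its parent. If the component has non-tree edges, the complete messages carry the smallest one, $e$, up to the root and the finished messages carry it down; a cuckoo action along the path from one endpoint of $e$ to the root then stores $e$ at that endpoint and moves each item on the path to the parent of its vertex. The items of all other non-tree edges go to the stash. \textbf{Lemma.} The message complexity of the MapReduce BFS algorithm on the cuckoo graph is $O(n)$ with very high probability. That is, for every $\varepsilon\in(0,1)$ there is a constant $C$, depending only on $\varepsilon$, such that for every $\alpha>0$ there is a constant $K$, depending only on $\varepsilon$ and $\alpha$, with $$\Pr\bigl(\text{message complexity}>C\,n\bigr)\;\le\;\frac{K}{n^{\alpha}}$$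 for all $m$ and all $X$ with $|X|=n$, $1\le n\le(1-\varepsilon)m$. -/

import Mathlib

open MeasureTheory ProbabilityTheory

universe u v

/-! ### MapReduce computations and their message complexity -/

/-- A MapReduce algorithm on values of type `α`, with keys in `κ`, intermediate values in `ν` and
final (output) values in `β`.  The reduction function sees one key and the list of all values with
that key; it produces non-final values (`Sum.inl`), which are the input of the next map step, and
final values (`Sum.inr`), which are output. -/
structure MapReduce (α κ ν β : Type*) where
  mapStep : α → κ × ν
  reduceStep : κ → List ν → List (α ⊕ β)

namespace MapReduce

variable {α κ ν β : Type*} [DecidableEq κ] (A : MapReduce α κ ν β)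

/-- The key-value pairs that the map step produces from the values `X`. -/
def mapped (X : List α) : List (κ × ν) := X.map A.mapStep

/-- The shuffle step: one list `(k; v₁, v₂, …)` for every key `k` that occurs. -/
def shuffle (L : List (κ × ν)) : List (κ × List ν) :=
  (L.map Prod.fst).dedup.map fun k => (k, (L.filter fun p => p.1 = k).map Prod.snd)

/-- Everything that the reduce step of a phase with input `X` produces. -/
def produced (X : List α) : List (α ⊕ β) :=
  (shuffle (A.mapped X)).flatMap fun L => A.reduceStep L.1 L.2

/-- The non-final values that one phase produces from `X`. -/
def phase (X : List α) : List α := (A.produced X).filterMap Sum.getLeft?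

/-- The values that are present at the beginning of phase `i`, on input `X`. -/
def run (X : List α) (i : ℕ) : List α := A.phase^[i] X

/-- The total size of a family of lists `(k; v₁, v₂, …)`, the keys included. -/
def listsSize (S : List (κ × List ν)) : ℕ := (S.map fun L => 1 + L.2.length).sum

/-- The total size of the inputs and outputs of the map, the shuffle and the reduce step of one
phase with input `X`. -/
def phaseSize (X : List α) : ℕ :=
  (X.length + (A.mapped X).length)
    + ((A.mapped X).length + listsSize (shuffle (A.mapped X)))
    + (listsSize (shuffle (A.mapped X)) + (A.produced X).length)

/-- The message complexity on input `X`: the sum of the sizes of all phases (it is `⊤` if that sum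
diverges; phases without any values contribute `0`). -/
noncomputable def messageComplexity (X : List α) : ℕ∞ :=
  ⨆ t : ℕ, ((∑ i ∈ Finset.range t, A.phaseSize (A.run X i) : ℕ) : ℕ∞)

/-- The reduction function computed by a streaming algorithm that scans the list of values with
working storage `σ`: a first scan (`load`), a second scan (`scan`), and a last one during which
output is produced for every value (`emit`), and once more at the end of the list (`close`). -/
def streaming {σ : Type*} (start : σ) (load : σ → ν → σ) (scan : κ → σ → ν → σ)
    (emit : κ → σ → ν → List (α ⊕ β)) (close : κ → σ → List (α ⊕ β)) :
    κ → List ν → List (α ⊕ β) := fun k L =>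
  let s := L.foldl (scan k) (L.foldl load start)
  L.flatMap (emit k s) ++ close k s

end MapReduce

/-! ### Simultaneous breadth-first searches

`V` is the ordered type of vertices and `I` the ordered type of items; every item is an edge, and
parallel edges are allowed. -/

namespace CuckooBFS

/-- The record kept for a vertex. -/
structure Label (V I : Type*) where
  /-- the root of the search that the vertex currently belongs to -/
  component : V
  /-- the parent in the search tree (the vertex itself, for a root) -/
  parent : V
  /-- the edge to the parent (`none` for a root) -/
  parentItem : Option I
  /-- the vertex is just now pushing the wave of its search to its neighbors -/
  active : Bool
  /-- the vertex has pushed the wave and waits for its children -/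
  pending : Bool
  /-- all of the subtree below the vertex has confirmed that it belongs to the same search -/
  complete : Bool
  /-- the root is complete, and the vertex knows it -/
  finished : Bool
  /-- for a complete vertex, `(e, j)` where `e` is the smallest non-tree edge charged to its subtree,
  and `j` is the item that the vertex stores if the cuckoo action is performed for `e`
  (a non-tree edge is charged to its smaller end; `none` if no such edge exists) -/
  surplus : Option (I ×ₗ I)
  /-- for a finished vertex, the non-tree edge of the component for which the cuckoo action is
  performed (`none` if the component is a tree) -/
  chosen : Option I

/-- The values processed by the algorithm, each of constant size. -/
inductive Value (V I : Type*) where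
  /-- an input value: the item `i` with its two candidate locations `u` and `w` -/
  | edge (i : I) (u w : V)
  /-- the edge `i`, as seen from its end `v`, whose other end is `w` -/
  | half (i : I) (v w : V)
  /-- the current record of the vertex `v` -/
  | node (v : V) (l : Label V I)
  /-- a message along the edge `i` from `v` to `w`, with the current record of `v` -/
  | arc (i : I) (v w : V) (l : Label V I)

/-- The final values. -/
inductive Output (V I : Type*) where
  /-- the root of the search tree that contains `v`, the parent of `v` and the edge to it, and the
  item that is stored at the location `v` -/
  | vertex (v root parent : V) (parentItem stored : Option I)
  /-- is the edge `i` a tree edge, and does the item `i` go to the stash? -/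
  | edge (i : I) (tree stash : Bool)

/-- The working storage of the reduction function at a vertex. -/
structure Registers (V I : Type*) where
  /-- the record of the vertex -/
  self : Option (Label V I)
  /-- is this the phase in which the vertex is created? -/
  fresh : Bool
  /-- the minimum of (component, neighbor, edge) over the active neighbors -/
  push : Option (V ×ₗ V ×ₗ I)
  /-- do all neighbors belong to the same search as the vertex? -/
  agree : Bool
  childrenComplete : Bool
  childrenFinished : Bool
  parentFinished : Bool
  /-- the field `chosen` of the parent -/
  parentChosen : Option I
  /-- the minimum of the candidates for the field `surplus` -/
  surplus : Option (I ×ₗ I)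

section

variable {V I : Type*} [LinearOrder V] [LinearOrder I]

/-- Every vertex starts as the active root of a search of its own. -/
def Label.init (v : V) : Label V I where
  component := v
  parent := v
  parentItem := none
  active := true
  pending := false
  complete := false
  finished := false
  surplus := none
  chosen := none

/-- The vertex joins the search `c`, as a child of `p` through the edge `i`; all work done for
an earlier search is discarded. -/
def Label.join (c p : V) (i : I) : Label V I where
  component := c
  parent := p
  parentItem := some i
  active := true
  pending := false
  complete := false
  finished := false
  surplus := none
  chosen := none

def Registers.start : Registers V I where
  self := none
  fresh := false
  push := none
  agree := true
  childrenComplete := true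
  childrenFinished := true
  parentFinished := false
  parentChosen := none
  surplus := none

/-- The first scan looks for the record of the vertex. -/
def load (r : Registers V I) : Value V I → Registers V I
  | .edge _ _ _ => r
  | .half _ _ _ => { r with fresh := true }
  | .node _ l => { r with self := some l }
  | .arc _ _ _ _ => r

/-- The candidate for `surplus` at the vertex `v` with record `s` that comes from the edge `i` to
the vertex `u` with record `l`: if `u` is a child of `v`, this is the surplus edge of `u`, and
the cuckoo action moves the item `i` from `u` to `v`; if `i` is a non-tree edge charged to `v`, it
is `i` itself. -/
def surplusAt (v : V) (s : Label V I) (i : I) (u : V) (l : Label V I) : Option (I ×ₗ I) :=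
  if l.parentItem = some i then l.surplus.map fun e => toLex ((ofLex e).1, i)
  else if s.parentItem ≠ some i ∧ v < u then some (toLex (i, i))
  else none

/-- The second scan collects minima and conjunctions over the messages from the neighbors. -/
def scan (v : V) (r : Registers V I) : Value V I → Registers V I
  | .edge _ _ _ => r
  | .half _ _ _ => r
  | .node _ _ => r
  | .arc i u _ l =>
    match r.self with
    | none => r
    | some s =>
      { r with
        push := if l.active then
            Option.merge min r.push (some (toLex (l.component, toLex (u, i)))) else r.push
        agree := r.agree && decide (l.component = s.component)
        childrenComplete :=
          r.childrenComplete && (decide (l.parentItem ≠ some i) || l.complete)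
        childrenFinished :=
          r.childrenFinished && (decide (l.parentItem ≠ some i) || l.finished)
        parentFinished := r.parentFinished || (decide (s.parentItem = some i) && l.finished)
        parentChosen := if s.parentItem = some i then l.chosen else r.parentChosen
        surplus := Option.merge min r.surplus (surplusAt v s i u l) }

/-- What a vertex with record `s` does in one iteration if no search with a smaller root has
reached it. -/
def advance (r : Registers V I) (s : Label V I) : Label V I :=
  let pending := s.pending || s.active
  let complete := s.complete || (pending && r.agree && r.childrenComplete)
  let surplus := if s.complete then s.surplus else if complete then r.surplus else none
  let finished := s.finished || (complete && (s.parentItem.isNone || r.parentFinished))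
  { s with
    active := false
    pending := pending
    complete := complete
    finished := finished
    surplus := surplus
    chosen :=
      if s.finished then s.chosen
      else if finished then
        if s.parentItem.isNone then surplus.map fun e => (ofLex e).1 else r.parentChosen
      else none }

/-- The new record of a vertex with record `s`: a search with a smaller root wins. -/
def update (r : Registers V I) (s : Label V I) : Label V I :=
  match r.push with
  | none => advance r s
  | some q =>
    if (ofLex q).1 < s.component then
      Label.join (ofLex q).1 (ofLex (ofLex q).2).1 (ofLex (ofLex q).2).2
    else advance r s

/-- A vertex with the new record `s` is final, and is not processed any more, if it and all of its
children are finished. -/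
def isFinal (r : Registers V I) (s : Label V I) : Bool := s.finished && r.childrenFinished

/-- The item stored at a final vertex: the edge to the parent, unless the vertex lies on the path
of the cuckoo action. -/
def Label.stored (s : Label V I) : Option I :=
  match s.surplus with
  | none => s.parentItem
  | some e => if s.chosen = some (ofLex e).1 then some (ofLex e).2 else s.parentItem

/-- In the first phase each edge is announced to both of its ends, and in the second one the
vertices are created.  From then on, in every phase each vertex updates its record and sends it along
all of its edges that are still in use, until it becomes final; messages to final vertices are
dropped. -/
def emit (v : V) (r : Registers V I) : Value V I → List (Value V I ⊕ Output V I)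
  | .edge i u w => [.inl (.half i u w), .inl (.half i w u)]
  | .half i _ w => [.inl (.arc i v w (Label.init v))]
  | .node _ _ => []
  | .arc i u _ l =>
    match r.self with
    | none => []
    | some s =>
      let s' := update r s
      if isFinal r s' then
        let tree := decide (s'.parentItem = some i) || decide (l.parentItem = some i)
        [.inr (.edge i tree (!tree && decide (s'.chosen ≠ some i)))]
      else [.inl (.arc i v u s')]

/-- The record of the vertex itself, which is passed on to the next phase or output. -/
def close (v : V) (r : Registers V I) : List (Value V I ⊕ Output V I) :=
  match r.self with
  | none => if r.fresh then [.inl (.node v (Label.init v))] else []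
  | some s =>
    let s' := update r s
    if isFinal r s' then [.inr (.vertex v s'.component s'.parent s'.parentItem s'.stored)]
    else [.inl (.node v s')]

/-- The vertex that a value is sent to. -/
def Value.dest : Value V I → V
  | .edge _ u _ => u
  | .half _ v _ => v
  | .node v _ => v
  | .arc _ _ w _ => w

/-- The MapReduce algorithm for simultaneous breadth-first searches in a multigraph, with the cuckoo
actions on the search trees. -/
def algorithm (V I : Type*) [LinearOrder V] [LinearOrder I] :
    MapReduce (Value V I) V (Value V I) (Output V I) where
  mapStep x := (x.dest, x)
  reduceStep := MapReduce.streaming Registers.start load scan emit close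

end

/-- The input of the algorithm for the set `X` of items and hash functions `h₁`, `h₂` into two tables
of `m` cells each: the edges of the cuckoo graph.  The cells of the second table are numbered
after those of the first one. -/
def input {𝒳 : Type*} [LinearOrder 𝒳] {m : ℕ} (X : Finset 𝒳) (h₁ h₂ : 𝒳 → Fin m) :
    List (Value (Fin (m + m)) 𝒳) :=
  (X.sort (· ≤ ·)).map fun x => .edge x (Fin.castAdd m (h₁ x)) (Fin.natAdd m (h₂ x))

/-- The message complexity of the MapReduce BFS algorithm on the cuckoo graph. -/
noncomputable def messageComplexity {𝒳 : Type*} [LinearOrder 𝒳] {m : ℕ} (X : Finset 𝒳)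
    (h₁ h₂ : 𝒳 → Fin m) : ℕ∞ :=
  (algorithm (Fin (m + m)) 𝒳).messageComplexity (input X h₁ h₂)

/-- `h₁` and `h₂` are two independent, completely random hash functions with `m` possible values. -/
structure RandomHashFunctions {𝒳 Ω : Type*} [MeasurableSpace Ω] (P : Measure Ω) {m : ℕ}
    (h₁ h₂ : 𝒳 → Ω → Fin m) : Prop where
  measurable₁ : ∀ x, Measurable (h₁ x)
  measurable₂ : ∀ x, Measurable (h₂ x)
  uniform₁ : ∀ x a, P {ω | h₁ x ω = a} = (m : ENNReal)⁻¹
  uniform₂ : ∀ x a, P {ω | h₂ x ω = a} = (m : ENNReal)⁻¹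
  indep : iIndepFun (Sum.elim h₁ h₂) P

end CuckooBFS

/-! The cost is bounded deterministically by a constant times the sum of the squares of the
component sizes, and this sum is linear outside an event of probability `O(exp (-√n))`.

Deterministic half. A phase costs at most ten times the number of its values (`phaseSize_le`). After
two set-up phases these values are the records of the vertices still processed and messages along
arcs leaving them (`exists_isState`), so it suffices to bound the lifetime of a vertex. Let `M` be
the smallest vertex of a component and `e` its eccentricity. The search from `M` captures the
component in `e` iterations, completeness climbs back to `M` in about `e` more, and finishing
descends in another `e`. The delicate point is that no search from a larger root ends prematurely: a
root can be complete only if every vertex of the component was complete in that search, at a time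
earlier by its distance (`complete_of_root_complete`). In particular `M` was complete, so nothing
finishes before `M` is complete (`not_finished`), and every lifetime is below `3 * e + 2`
(`lt_of_alive`). As `e` is at most the number of items in the component, `messageComplexity_le`
follows.

Probabilistic half. Put `L = √n` and `ψ k = θ * min (k / L) 1`. The main estimate is that the
exponential moment of the sum of `ψ` of the component sizes is `exp (O(L))` (`sum_exp_cluster_le`).
The hash values are revealed lazily, one component at a time; each item found carries a factor `ζ`
and each unexplored cell a factor `s`. Exploring a cell asks every remaining item whether it lies
there, and the expected factor this creates is at most `exp (r * (ζ * s - 1)) ≤ s`, which the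
explored cell pays for. The load bound `n ≤ (1 - ε) m` is what allows such `s, ζ > 1`. Each
component then costs a factor `1 + O(1 / L)`, and `(1 + O(1 / L)) ^ n = exp (O(L))` (`momentBound`).
By Markov's inequality the sum of `ψ` is `O(L)` outside an `exp (-L)` fraction of all hash
functions. The truncation in `ψ` is then harmless: every component has `O(L)` items, so `ψ` is
comparable to size over `L` (`sum_cluster_card_le`). Finally `exp (-√n)` beats every power of `n`,
with `C` independent of `α`. -/

set_option linter.unusedSectionVars false

/-! ### A MapReduce phase, up to the order of its values. -/

namespace List

/-- Grouping the elements of a list by a key, and treating each group in turn, amounts to treating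
the elements one by one. -/
theorem flatMap_filter_key_perm {α κ β : Type*} [DecidableEq κ] (key : α → κ) (g : κ → α → List β)
    {K : List κ} (hK : K.Nodup) {X : List α} (hX : ∀ x ∈ X, key x ∈ K) :
    (K.flatMap fun k => (X.filter fun x => key x = k).flatMap (g k)).Perm
      (X.flatMap fun x => g (key x) x) := by
  induction X with
  | nil => simp
  | cons x X ih =>
    have h1 : ∀ k, (((x :: X).filter fun y => key y = k).flatMap (g k)) =
        (if key x = k then g k x else []) ++ ((X.filter fun y => key y = k).flatMap (g k)) := by
      intro k
      by_cases h : key x = k <;> simp [h]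
    have h2 : ∀ K : List κ, K.Nodup → key x ∈ K →
        (K.flatMap fun k => if key x = k then g k x else []) = g (key x) x := by
      intro K hK hx
      induction K with
      | nil => simp at hx
      | cons k K ihK =>
        rw [List.nodup_cons] at hK
        by_cases h : key x = k
        · subst h
          have : (K.flatMap fun k => if key x = k then g k x else []) = [] := by
            rw [List.flatMap_eq_nil_iff]
            intro k hk
            rw [if_neg]
            rintro rfl
            exact hK.1 hk
          simp [this]
        · have hx' : key x ∈ K := by simpa [h] using hx
          simp [h, ihK hK.2 hx']
    simp only [h1]
    refine (List.flatMap_append_perm _ _ _).symm.trans ?_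
    rw [h2 K hK (hX x (by simp)), List.flatMap_cons]
    exact (ih fun y hy => hX y (by simp [hy])).append_left _

end List

namespace CuckooBFS

variable {V I : Type*} [LinearOrder V] [LinearOrder I]

/-- The registers at the vertex `k` after both scans of the list `L`. -/
def registers (k : V) (L : List (Value V I)) : Registers V I :=
  L.foldl (scan k) (L.foldl load Registers.start)

/-- The values that are sent to the vertex `k`. -/
def inbox (X : List (Value V I)) (k : V) : List (Value V I) := X.filter fun x => x.dest = k

/-- The vertices that receive a value. -/
def keys (X : List (Value V I)) : List V := (X.map Value.dest).dedup

theorem mem_inbox {X : List (Value V I)} {k : V} {x : Value V I} :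
    x ∈ inbox X k ↔ x ∈ X ∧ x.dest = k := by
  simp [inbox]

theorem mem_keys {X : List (Value V I)} {k : V} : k ∈ keys X ↔ ∃ x ∈ X, x.dest = k := by
  simp [keys]

theorem shuffle_mapped (X : List (Value V I)) :
    MapReduce.shuffle ((algorithm V I).mapped X) = (keys X).map fun k => (k, inbox X k) := by
  have h1 : (X.map (algorithm V I).mapStep).map Prod.fst = X.map Value.dest := by
    simp [algorithm, Function.comp_def]
  have h2 : ∀ k, (((X.map (algorithm V I).mapStep).filter fun p => p.1 = k).map Prod.snd) =
      inbox X k := by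
    intro k
    simp [algorithm, inbox, List.filter_map, Function.comp_def]
  simp only [MapReduce.shuffle, MapReduce.mapped, h1, h2, keys]

/-- Working up to permutation makes a phase act on each value separately, given only the registers
of its destination. -/
theorem produced_perm (X : List (Value V I)) :
    ((algorithm V I).produced X).Perm
      ((X.flatMap fun x => emit x.dest (registers x.dest (inbox X x.dest)) x) ++
        (keys X).flatMap fun k => close k (registers k (inbox X k))) := by
  have h : (algorithm V I).produced X = (keys X).flatMap fun k =>
      (inbox X k).flatMap (emit k (registers k (inbox X k))) ++
        close k (registers k (inbox X k)) := by
    rw [MapReduce.produced, shuffle_mapped, List.flatMap_map]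
    rfl
  rw [h]
  refine (List.flatMap_append_perm _ _ _).symm.trans (List.Perm.append_right _ ?_)
  exact List.flatMap_filter_key_perm Value.dest (fun k => emit k (registers k (inbox X k)))
    (List.nodup_dedup _) fun x hx => mem_keys.2 ⟨x, hx, rfl⟩

theorem phase_perm (X : List (Value V I)) :
    ((algorithm V I).phase X).Perm
      ((X.flatMap fun x =>
          (emit x.dest (registers x.dest (inbox X x.dest)) x).filterMap Sum.getLeft?) ++
        (keys X).flatMap fun k =>
          (close k (registers k (inbox X k))).filterMap Sum.getLeft?) := by
  have h := (produced_perm X).filterMap Sum.getLeft?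
  rwa [List.filterMap_append, List.filterMap_flatMap, List.filterMap_flatMap] at h

theorem length_keys_le (X : List (Value V I)) : (keys X).length ≤ X.length := by
  simpa [keys] using (List.dedup_sublist (X.map Value.dest)).length_le

theorem length_emit_le (v : V) (r : Registers V I) (x : Value V I) : (emit v r x).length ≤ 2 := by
  cases x with
  | arc i u w l =>
    rw [emit]
    split
    · simp
    · simp only
      split <;> simp
  | _ => simp [emit]

theorem length_close_le (v : V) (r : Registers V I) : (close v r).length ≤ 1 := by
  rw [close]
  split
  · split <;> simp
  · simp only
    split <;> simp

theorem length_flatMap_le {α β : Type*} (f : α → List β) (c : ℕ) (h : ∀ x, (f x).length ≤ c)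
    (L : List α) : (L.flatMap f).length ≤ c * L.length := by
  rw [List.length_flatMap, mul_comm]
  have := List.sum_le_card_nsmul (L.map fun x => (f x).length) c (by simpa using fun x _ => h x)
  simpa using this

/-- Each value produces at most two values and each key at most one, so the total is at most seven
times the number of values plus three times the number of keys. -/
theorem phaseSize_le (X : List (Value V I)) : (algorithm V I).phaseSize X ≤ 10 * X.length := by
  have h1 : ((algorithm V I).mapped X).length = X.length := by simp [MapReduce.mapped]
  have h2 : MapReduce.listsSize (MapReduce.shuffle ((algorithm V I).mapped X)) =
      (keys X).length + X.length := by
    rw [shuffle_mapped, MapReduce.listsSize, List.map_map]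
    have h := (List.flatMap_filter_key_perm Value.dest (fun _ x => [x]) (K := keys X) (X := X)
      (List.nodup_dedup _) fun x hx => mem_keys.2 ⟨x, hx, rfl⟩).length_eq
    simp only [List.length_flatMap, List.flatMap_singleton'] at h
    rw [show ((fun L : V × List (Value V I) => 1 + L.2.length) ∘ fun k => (k, inbox X k)) =
      fun k => 1 + (inbox X k).length from rfl, List.sum_map_add]
    simp only [inbox]
    simp at h ⊢
    exact h
  have h3 : ((algorithm V I).produced X).length ≤ 2 * X.length + 1 * (keys X).length := by
    rw [(produced_perm X).length_eq, List.length_append]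
    exact Nat.add_le_add
      (length_flatMap_le _ 2 (fun x => length_emit_le _ _ _) _)
      (length_flatMap_le _ 1 (fun x => length_close_le _ _) _)
  have h4 := length_keys_le X
  rw [MapReduce.phaseSize, h1, h2]
  omega

/-! ### The registers -/

theorem foldl_load_fields (L : List (Value V I)) (r : Registers V I) :
    (L.foldl load r).push = r.push ∧ (L.foldl load r).agree = r.agree ∧
      (L.foldl load r).childrenComplete = r.childrenComplete ∧
      (L.foldl load r).childrenFinished = r.childrenFinished ∧
      (L.foldl load r).parentFinished = r.parentFinished := by
  induction L generalizing r with
  | nil => simp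
  | cons x L ih =>
    obtain ⟨h1, h2, h3, h4, h5⟩ := ih (load r x)
    rw [List.foldl_cons, h1, h2, h3, h4, h5]
    cases x <;> simp [load]

theorem foldl_load_self_of_forall_ne (L : List (Value V I)) (r : Registers V I)
    (h : ∀ v l, Value.node v l ∉ L) : (L.foldl load r).self = r.self := by
  induction L generalizing r with
  | nil => simp
  | cons x L ih =>
    rw [List.foldl_cons, ih _ fun v l hl => h v l (by simp [hl])]
    cases x with
    | node v l => exact absurd (by simp) (h v l)
    | _ => rfl

/-- `load` keeps the last record it reads; since all records in the list agree, overwriting is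
harmless. -/
theorem foldl_load_self (L : List (Value V I)) (r : Registers V I) {l₀ : Label V I}
    (h : ∀ v l, Value.node v l ∈ L → l = l₀) (h' : r.self = some l₀ ∨ ∃ v, Value.node v l₀ ∈ L) :
    (L.foldl load r).self = some l₀ := by
  induction L generalizing r with
  | nil => simpa using h'
  | cons x L ih =>
    rw [List.foldl_cons]
    refine ih _ (fun v l hl => h v l (by simp [hl])) ?_
    cases x with
    | node v l => exact Or.inl (by simp [load, h v l (by simp)])
    | _ => simpa [load] using h'

theorem foldl_load_fresh (L : List (Value V I)) (r : Registers V I) :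
    (L.foldl load r).fresh = true ↔ r.fresh = true ∨ ∃ i v w, Value.half i v w ∈ L := by
  induction L generalizing r with
  | nil => simp
  | cons x L ih =>
    rw [List.foldl_cons, ih]
    cases x with
    | half i v w => simp only [load, true_or, true_iff]; exact Or.inr ⟨i, v, w, by simp⟩
    | _ => simp [load]

theorem scan_self (k : V) (r : Registers V I) (x : Value V I) : (scan k r x).self = r.self := by
  cases x with
  | arc i u w l => rw [scan]; split <;> simp_all
  | _ => rfl

theorem scan_fresh (k : V) (r : Registers V I) (x : Value V I) : (scan k r x).fresh = r.fresh := by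
  cases x with
  | arc i u w l => rw [scan]; split <;> simp_all
  | _ => rfl

theorem foldl_scan_self (k : V) (L : List (Value V I)) (r : Registers V I) :
    (L.foldl (scan k) r).self = r.self := by
  induction L generalizing r with
  | nil => rfl
  | cons x L ih => rw [List.foldl_cons, ih, scan_self]

theorem foldl_scan_fresh (k : V) (L : List (Value V I)) (r : Registers V I) :
    (L.foldl (scan k) r).fresh = r.fresh := by
  induction L generalizing r with
  | nil => rfl
  | cons x L ih => rw [List.foldl_cons, ih, scan_fresh]

theorem foldl_scan_agree (k : V) (L : List (Value V I)) (r : Registers V I) {s : Label V I}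
    (hs : r.self = some s) :
    (L.foldl (scan k) r).agree = true ↔
      r.agree = true ∧ ∀ i u w l, Value.arc i u w l ∈ L → l.component = s.component := by
  induction L generalizing r with
  | nil => simp
  | cons x L ih =>
    rw [List.foldl_cons, ih _ (by rw [scan_self, hs])]
    cases x with
    | arc i u w l =>
      simp only [scan, hs, Bool.and_eq_true, decide_eq_true_eq, and_assoc]
      refine and_congr_right fun _ => ⟨?_, fun h => ⟨h i u w l (by simp), fun i u w l hl => h i u w l (by simp [hl])⟩⟩
      rintro ⟨h, h'⟩ i' u' w' l' hm
      rcases List.mem_cons.1 hm with hm | hm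
      · cases hm
        exact h
      · exact h' i' u' w' l' hm
    | _ => simp [scan]

theorem foldl_scan_childrenComplete (k : V) (L : List (Value V I)) (r : Registers V I)
    {s : Label V I} (hs : r.self = some s) :
    (L.foldl (scan k) r).childrenComplete = true ↔
      r.childrenComplete = true ∧
        ∀ i u w l, Value.arc i u w l ∈ L → l.parentItem = some i → l.complete = true := by
  induction L generalizing r with
  | nil => simp
  | cons x L ih =>
    rw [List.foldl_cons, ih _ (by rw [scan_self, hs])]
    cases x with
    | arc i u w l =>
      simp only [scan, hs, Bool.and_eq_true, Bool.or_eq_true, ne_eq, decide_eq_true_eq, and_assoc]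
      refine and_congr_right fun _ => ⟨?_, fun h => ⟨by
        rw [← imp_iff_not_or]; exact h i u w l (by simp), fun i u w l hl => h i u w l (by simp [hl])⟩⟩
      rintro ⟨h, h'⟩ i' u' w' l' hm
      rcases List.mem_cons.1 hm with hm | hm
      · cases hm
        exact imp_iff_not_or.2 h
      · exact h' i' u' w' l' hm
    | _ => simp [scan]

theorem foldl_scan_childrenFinished (k : V) (L : List (Value V I)) (r : Registers V I)
    {s : Label V I} (hs : r.self = some s) :
    (L.foldl (scan k) r).childrenFinished = true ↔
      r.childrenFinished = true ∧
        ∀ i u w l, Value.arc i u w l ∈ L → l.parentItem = some i → l.finished = true := by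
  induction L generalizing r with
  | nil => simp
  | cons x L ih =>
    rw [List.foldl_cons, ih _ (by rw [scan_self, hs])]
    cases x with
    | arc i u w l =>
      simp only [scan, hs, Bool.and_eq_true, Bool.or_eq_true, ne_eq, decide_eq_true_eq, and_assoc]
      refine and_congr_right fun _ => ⟨?_, fun h => ⟨by
        rw [← imp_iff_not_or]; exact h i u w l (by simp), fun i u w l hl => h i u w l (by simp [hl])⟩⟩
      rintro ⟨h, h'⟩ i' u' w' l' hm
      rcases List.mem_cons.1 hm with hm | hm
      · cases hm
        exact imp_iff_not_or.2 h
      · exact h' i' u' w' l' hm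
    | _ => simp [scan]

theorem foldl_scan_parentFinished (k : V) (L : List (Value V I)) (r : Registers V I)
    {s : Label V I} (hs : r.self = some s) :
    (L.foldl (scan k) r).parentFinished = true ↔
      r.parentFinished = true ∨
        ∃ i u w l, Value.arc i u w l ∈ L ∧ s.parentItem = some i ∧ l.finished = true := by
  induction L generalizing r with
  | nil => simp
  | cons x L ih =>
    rw [List.foldl_cons, ih _ (by rw [scan_self, hs])]
    cases x with
    | arc i u w l =>
      simp only [scan, hs, Bool.or_eq_true, Bool.and_eq_true, decide_eq_true_eq, or_assoc]
      refine or_congr_right ⟨?_, ?_⟩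
      · rintro (h | ⟨i', u', w', l', hm, h⟩)
        · exact ⟨i, u, w, l, by simp, h⟩
        · exact ⟨i', u', w', l', by simp [hm], h⟩
      · rintro ⟨i', u', w', l', hm, h⟩
        rcases List.mem_cons.1 hm with hm | hm
        · cases hm
          exact Or.inl h
        · exact Or.inr ⟨i', u', w', l', hm, h⟩
    | _ => simp [scan]

/-- The two halves characterize a minimum: it is attained, and it is a lower bound. The initial
value of the register takes part so that the induction on the list goes through. -/
theorem foldl_scan_push (k : V) (L : List (Value V I)) (r : Registers V I)
    {s : Label V I} (hs : r.self = some s) :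
    (∀ q, (L.foldl (scan k) r).push = some q → r.push = some q ∨
      ∃ i u w l, Value.arc i u w l ∈ L ∧ l.active = true ∧
        q = toLex (l.component, toLex (u, i))) ∧
    (∀ q, (r.push = some q ∨ ∃ i u w l, Value.arc i u w l ∈ L ∧ l.active = true ∧
        q = toLex (l.component, toLex (u, i))) →
      ∃ q', (L.foldl (scan k) r).push = some q' ∧ q' ≤ q) := by
  induction L generalizing r with
  | nil => exact ⟨fun q h => Or.inl h, fun q h => ⟨q, by simpa using h, le_rfl⟩⟩
  | cons x L ih =>
    obtain ⟨h1, h2⟩ := ih (scan k r x) (by rw [scan_self, hs])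
    rw [List.foldl_cons]
    cases x with
    | arc i u w l =>
      have hp : (scan k r (.arc i u w l)).push = if l.active then
          Option.merge min r.push (some (toLex (l.component, toLex (u, i)))) else r.push := by
        simp [scan, hs]
      rw [hp] at h1 h2
      constructor
      · intro q hq
        rcases h1 q hq with h | ⟨i', u', w', l', hm, ha, he⟩
        · split at h
          · rename_i ha
            cases hr : r.push with
            | none =>
              rw [hr] at h
              simp at h
              exact Or.inr ⟨i, u, w, l, by simp, ha, h.symm⟩
            | some q₀ =>
              rw [hr] at h
              simp at h
              rcases min_choice q₀ (toLex (l.component, toLex (u, i))) with hm | hm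
              · rw [hm] at h; exact Or.inl (by rw [h])
              · rw [hm] at h; exact Or.inr ⟨i, u, w, l, by simp, ha, h.symm⟩
          · exact Or.inl h
        · exact Or.inr ⟨i', u', w', l', by simp [hm], ha, he⟩
      · rintro q (hq | ⟨i', u', w', l', hm, ha, he⟩)
        · by_cases ha : l.active
          · obtain ⟨q', hq', hle⟩ := h2 (min q (toLex (l.component, toLex (u, i))))
              (Or.inl (by simp [ha, hq]))
            exact ⟨q', hq', hle.trans (min_le_left _ _)⟩
          · exact h2 q (Or.inl (by simp [ha, hq]))
        · rcases List.mem_cons.1 hm with hm | hm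
          · cases hm
            cases hr : r.push with
            | none =>
              obtain ⟨q', hq', hle⟩ := h2 q (Or.inl (by simp [ha, hr, he]))
              exact ⟨q', hq', hle⟩
            | some q₀ =>
              obtain ⟨q', hq', hle⟩ := h2 (min q₀ q) (Or.inl (by simp [ha, hr, he]))
              exact ⟨q', hq', hle.trans (min_le_right _ _)⟩
          · exact h2 q (Or.inr ⟨i', u', w', l', hm, ha, he⟩)
    | _ =>
      refine ⟨fun q hq => ?_, fun q hq => h2 q ?_⟩
      · rcases h1 q hq with h | ⟨i, u, w, l, hm, h⟩
        · exact Or.inl h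
        · exact Or.inr ⟨i, u, w, l, by simp [hm], h⟩
      · rcases hq with h | ⟨i, u, w, l, hm, h⟩
        · exact Or.inl h
        · exact Or.inr ⟨i, u, w, l, by simpa using hm, h⟩

end CuckooBFS

/-! ### The state of the computation as labels on a multigraph. -/

namespace CuckooBFS

variable {V I : Type*} [LinearOrder V] [LinearOrder I]

/-- The two directed edges of every edge of a multigraph. -/
def arcs (E : List (I × V × V)) : List (I × V × V) :=
  E.flatMap fun e => [(e.1, e.2.1, e.2.2), (e.1, e.2.2, e.2.1)]

/-- The ends of the edges. -/
def verts (D : List (I × V × V)) : List V := (D.map fun a => a.2.1).dedup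

theorem mem_verts {D : List (I × V × V)} {v : V} : v ∈ verts D ↔ ∃ i w, (i, v, w) ∈ D := by
  simp [verts]

/-- The values in `X` are the records `ℓ` of the vertices in `al`, and these records on the arcs
from vertices in `al` to vertices in `al'`. -/
def IsState (D : List (I × V × V)) (al al' : V → Bool) (ℓ : V → Label V I)
    (X : List (Value V I)) : Prop :=
  X.Perm ((((verts D).filter al).map fun v => .node v (ℓ v)) ++
    (D.filter fun a => al a.2.1 && al' a.2.2).map fun a => .arc a.1 a.2.1 a.2.2 (ℓ a.2.1))

namespace IsState

variable {D : List (I × V × V)} {al al' : V → Bool} {ℓ : V → Label V I} {X : List (Value V I)}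

theorem node_mem (h : IsState D al al' ℓ X) {v : V} {l : Label V I} :
    Value.node v l ∈ X ↔ v ∈ verts D ∧ al v = true ∧ l = ℓ v := by
  rw [h.mem_iff]
  simp [and_assoc]
  grind

theorem arc_mem (h : IsState D al al' ℓ X) {i : I} {v w : V} {l : Label V I} :
    Value.arc i v w l ∈ X ↔ (i, v, w) ∈ D ∧ al v = true ∧ al' w = true ∧ l = ℓ v := by
  rw [h.mem_iff]
  simp [and_assoc]
  grind

theorem half_notMem (h : IsState D al al' ℓ X) (i : I) (v w : V) : Value.half i v w ∉ X := by
  rw [h.mem_iff]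
  simp

theorem registers_self (h : IsState D al al' ℓ X) {k : V} (hk : k ∈ verts D) (hal : al k = true) :
    (registers k (inbox X k)).self = some (ℓ k) := by
  rw [registers, foldl_scan_self]
  refine foldl_load_self _ _ (fun v l hl => ?_) (Or.inr ⟨k, ?_⟩)
  · simp only [mem_inbox, h.node_mem, Value.dest] at hl
    rw [hl.1.2.2, hl.2]
  · simp [inbox, h.node_mem, Value.dest, hk, hal]

theorem registers_self_none (h : IsState D al al' ℓ X) {k : V} (hal : al k = false) :
    (registers k (inbox X k)).self = none := by
  rw [registers, foldl_scan_self, foldl_load_self_of_forall_ne]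
  · rfl
  · intro v l hl
    simp only [mem_inbox, h.node_mem, Value.dest] at hl
    have := hl.2 ▸ hl.1.2.1
    simp [this] at hal

theorem registers_fresh (h : IsState D al al' ℓ X) (k : V) :
    (registers k (inbox X k)).fresh = false := by
  rw [registers, foldl_scan_fresh, ← Bool.not_eq_true, foldl_load_fresh]
  simp [Registers.start, inbox, h.half_notMem]

/-- Every vertex has an outgoing arc, so the records, like the messages, are no more numerous than
the arcs that leave processed vertices. -/
theorem length_le (h : IsState D al al' ℓ X) :
    X.length ≤ 2 * (D.filter fun a => al a.2.1).length := by
  have h1 : ((verts D).filter al).length ≤ (D.filter fun a => al a.2.1).length := by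
    have h2 : (verts D).filter al ⊆ (D.filter fun a => al a.2.1).map fun a => a.2.1 := by
      intro v hv
      rw [List.mem_filter, mem_verts] at hv
      obtain ⟨⟨i, w, hm⟩, hv⟩ := hv
      exact List.mem_map.2 ⟨(i, v, w), by simp [hm, hv], rfl⟩
    have := (List.Nodup.subperm ((List.nodup_dedup _).filter _) h2).length_le
    rwa [List.length_map] at this
  have h3 : (D.filter fun a => al a.2.1 && al' a.2.2).length ≤
      (D.filter fun a => al a.2.1).length := by
    rw [← List.countP_eq_length_filter, ← List.countP_eq_length_filter]
    exact List.countP_mono_left fun a _ ha => by simp at ha; exact ha.1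
  rw [List.Perm.length_eq h]
  simp only [List.length_append, List.length_map]
  omega

theorem mem_inbox_arc (h : IsState D al al' ℓ X) {i : I} {u w k : V} {l : Label V I} :
    Value.arc i u w l ∈ inbox X k ↔
      w = k ∧ (i, u, k) ∈ D ∧ al u = true ∧ al' k = true ∧ l = ℓ u := by
  simp only [mem_inbox, h.arc_mem, Value.dest]
  constructor
  · rintro ⟨h, rfl⟩; exact ⟨rfl, h⟩
  · rintro ⟨rfl, h⟩; exact ⟨h, rfl⟩

section

variable (h : IsState D al al' ℓ X) {k : V} (hk : k ∈ verts D) (hal : al k = true)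
  (hal' : al' k = true)

include h hk hal hal'

theorem registers_agree : (registers k (inbox X k)).agree = true ↔
    ∀ i u, (i, u, k) ∈ D → al u = true → (ℓ u).component = (ℓ k).component := by
  have hs := h.registers_self hk hal
  rw [registers, foldl_scan_self] at hs
  rw [registers, foldl_scan_agree _ _ _ hs, (foldl_load_fields _ _).2.1]
  simp only [Registers.start, true_and, h.mem_inbox_arc]
  exact ⟨fun H i u h1 h2 => H i u k _ ⟨rfl, h1, h2, hal', rfl⟩,
    fun H i u w l ⟨_, h1, h2, _, h3⟩ => h3 ▸ H i u h1 h2⟩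

theorem registers_childrenComplete : (registers k (inbox X k)).childrenComplete = true ↔
    ∀ i u, (i, u, k) ∈ D → al u = true → (ℓ u).parentItem = some i →
      (ℓ u).complete = true := by
  have hs := h.registers_self hk hal
  rw [registers, foldl_scan_self] at hs
  rw [registers, foldl_scan_childrenComplete _ _ _ hs, (foldl_load_fields _ _).2.2.1]
  simp only [Registers.start, true_and, h.mem_inbox_arc]
  exact ⟨fun H i u h1 h2 => H i u k _ ⟨rfl, h1, h2, hal', rfl⟩,
    fun H i u w l ⟨_, h1, h2, _, h3⟩ => h3 ▸ H i u h1 h2⟩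

theorem registers_childrenFinished : (registers k (inbox X k)).childrenFinished = true ↔
    ∀ i u, (i, u, k) ∈ D → al u = true → (ℓ u).parentItem = some i →
      (ℓ u).finished = true := by
  have hs := h.registers_self hk hal
  rw [registers, foldl_scan_self] at hs
  rw [registers, foldl_scan_childrenFinished _ _ _ hs, (foldl_load_fields _ _).2.2.2.1]
  simp only [Registers.start, true_and, h.mem_inbox_arc]
  exact ⟨fun H i u h1 h2 => H i u k _ ⟨rfl, h1, h2, hal', rfl⟩,
    fun H i u w l ⟨_, h1, h2, _, h3⟩ => h3 ▸ H i u h1 h2⟩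

theorem registers_parentFinished : (registers k (inbox X k)).parentFinished = true ↔
    ∃ i u, (i, u, k) ∈ D ∧ al u = true ∧ (ℓ k).parentItem = some i ∧
      (ℓ u).finished = true := by
  have hs := h.registers_self hk hal
  rw [registers, foldl_scan_self] at hs
  rw [registers, foldl_scan_parentFinished _ _ _ hs, (foldl_load_fields _ _).2.2.2.2]
  simp only [Registers.start, Bool.false_eq_true, false_or, h.mem_inbox_arc]
  constructor
  · rintro ⟨i, u, w, l, ⟨_, h1, h2, _, rfl⟩, h3, h4⟩
    exact ⟨i, u, h1, h2, h3, h4⟩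
  · rintro ⟨i, u, h1, h2, h3, h4⟩
    exact ⟨i, u, k, _, ⟨rfl, h1, h2, hal', rfl⟩, h3, h4⟩

theorem registers_push_mem {q : V ×ₗ V ×ₗ I} (hq : (registers k (inbox X k)).push = some q) :
    ∃ i u, (i, u, k) ∈ D ∧ al u = true ∧ (ℓ u).active = true ∧
      q = toLex ((ℓ u).component, toLex (u, i)) := by
  have hs := h.registers_self hk hal
  rw [registers, foldl_scan_self] at hs
  rcases (foldl_scan_push _ _ _ hs).1 q hq with h1 | ⟨i, u, w, l, h1, h2, h3⟩
  · rw [(foldl_load_fields _ _).1] at h1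
    simp [Registers.start] at h1
  · rw [h.mem_inbox_arc] at h1
    obtain ⟨_, h4, h5, _, rfl⟩ := h1
    exact ⟨i, u, h4, h5, h2, h3⟩

theorem registers_push_le {i : I} {u : V} (h1 : (i, u, k) ∈ D) (h2 : al u = true)
    (h3 : (ℓ u).active = true) :
    ∃ q, (registers k (inbox X k)).push = some q ∧ (ofLex q).1 ≤ (ℓ u).component := by
  have hs := h.registers_self hk hal
  rw [registers, foldl_scan_self] at hs
  obtain ⟨q, hq, hle⟩ := (foldl_scan_push _ _ _ hs).2 (toLex ((ℓ u).component, toLex (u, i)))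
    (Or.inr ⟨i, u, k, ℓ u, h.mem_inbox_arc.2 ⟨rfl, h1, h2, hal', rfl⟩, h3, rfl⟩)
  refine ⟨q, hq, ?_⟩
  rw [Prod.Lex.le_iff] at hle
  rcases hle with hle | hle
  · exact hle.le
  · exact hle.1.le

end

/-- One phase of the algorithm. -/
theorem phase (h : IsState D al al' ℓ X)
    (hD : (D.map fun a => (a.1, a.2.2, a.2.1)).Perm D)
    (hv : ∀ v, al v = true → v ∈ verts D) (hle : ∀ v, al v = true → al' v = true) :
    let ℓ' := fun v => update (registers v (inbox X v)) (ℓ v)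
    IsState D (fun v => al v && !isFinal (registers v (inbox X v)) (ℓ' v)) al ℓ'
      ((algorithm V I).phase X) := by
  intro ℓ'
  set al₁ : V → Bool := fun v => al v && !isFinal (registers v (inbox X v)) (ℓ' v) with hal₁
  refine (phase_perm X).trans (List.perm_append_comm.trans (List.Perm.append ?_ ?_))
  · have h1 : ∀ k, (CuckooBFS.close k (registers k (inbox X k))).filterMap Sum.getLeft? =
        if al₁ k = true then [Value.node k (ℓ' k)] else [] := by
      intro k
      cases hk : al k with
      | false => simp [CuckooBFS.close, h.registers_self_none hk, h.registers_fresh, hal₁, hk]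
      | true =>
        simp only [CuckooBFS.close, h.registers_self (hv k hk) hk, hal₁, hk, Bool.true_and]
        change List.filterMap _ (if isFinal _ (ℓ' k) = true then _ else [Sum.inl (Value.node k (ℓ' k))]) = _
        cases isFinal (registers k (inbox X k)) (ℓ' k) <;> simp
    have h2 : ∀ K : List V, (K.flatMap fun k =>
        (CuckooBFS.close k (registers k (inbox X k))).filterMap Sum.getLeft?) =
          (K.filter al₁).map fun k => Value.node k (ℓ' k) := by
      intro K
      induction K with
      | nil => rfl
      | cons k K ih =>
        rw [List.flatMap_cons, ih, h1, List.filter_cons]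
        split <;> simp
    rw [h2]
    refine List.Perm.map _ ((List.perm_ext_iff_of_nodup ((List.nodup_dedup _).filter _)
      ((List.nodup_dedup _).filter _)).2 fun v => ?_)
    simp only [List.mem_filter]
    refine and_congr_left fun hv₁ => ?_
    have hv₂ : al v = true := by simp [hal₁] at hv₁; exact hv₁.1
    exact iff_of_true (mem_keys.2 ⟨.node v (ℓ v), h.node_mem.2 ⟨hv v hv₂, hv₂, rfl⟩, rfl⟩)
      (hv v hv₂)
  · refine (List.Perm.flatMap_right _ h).trans ?_
    rw [List.flatMap_append, List.flatMap_map, List.flatMap_map]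
    have h1 : (((verts D).filter al).flatMap fun v =>
        (emit (Value.node v (ℓ v)).dest (registers (Value.node v (ℓ v)).dest
          (inbox X (Value.node v (ℓ v)).dest)) (Value.node v (ℓ v))).filterMap Sum.getLeft?) = [] := by
      simp [emit]
    rw [h1, List.nil_append]
    -- A vertex answers along the arc on which a message came in, with its new record; a vertex
    -- without a record drops the message.
    have h2 : ∀ i v w, (emit w (registers w (inbox X w)) (Value.arc i v w (ℓ v))).filterMap
        Sum.getLeft? = if al₁ w = true then [Value.arc i w v (ℓ' w)] else [] := by
      intro i v w
      cases hw : al w with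
      | false => simp [emit, h.registers_self_none hw, hal₁, hw]
      | true =>
        simp only [emit, h.registers_self (hv w hw) hw, hal₁, hw, Bool.true_and]
        change List.filterMap _ (if isFinal _ (ℓ' w) = true then _ else
          [Sum.inl (Value.arc i w v (ℓ' w))]) = _
        cases isFinal (registers w (inbox X w)) (ℓ' w) <;> simp
    -- Each answer goes to the sender of an old message, so `al` becomes the filter on the targets.
    -- The old filter `al'` disappears because `hle` makes it automatic at a processed vertex.
    have h3 : ∀ L : List (I × V × V),
        ((L.filter fun a => al a.2.1 && al' a.2.2).flatMap fun a =>
          (emit a.2.2 (registers a.2.2 (inbox X a.2.2))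
            (Value.arc a.1 a.2.1 a.2.2 (ℓ a.2.1))).filterMap Sum.getLeft?) =
        (((L.map fun a => (a.1, a.2.2, a.2.1)).filter fun a => al₁ a.2.1 && al a.2.2).map
          fun a => Value.arc a.1 a.2.1 a.2.2 (ℓ' a.2.1)) := by
      intro L
      induction L with
      | nil => rfl
      | cons a L ih =>
        rw [List.filter_cons, List.map_cons, List.filter_cons]
        cases h4 : al₁ a.2.2 with
        | false =>
          simp only [Bool.false_and, Bool.false_eq_true, if_false]
          split
          · rw [List.flatMap_cons, h2, h4, ih]; simp
          · exact ih
        | true =>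
          have h5 : al a.2.2 = true := by simp [hal₁] at h4; exact h4.1
          simp only [hle _ h5, Bool.and_true, Bool.true_and]
          split
          · rw [List.flatMap_cons, h2, h4, ih]; simp
          · exact ih
    exact (List.Perm.of_eq (h3 D)).trans ((hD.filter _).map _)

end IsState

/-- A search with a smaller root reaches `v`, whose record changes from `ℓ v` to `l'`. -/
def Joins (D : List (I × V × V)) (al : V → Bool) (ℓ : V → Label V I) (v : V)
    (l' : Label V I) : Prop :=
  ∃ i u, (i, u, v) ∈ D ∧ al u = true ∧ (ℓ u).active = true ∧
    (ℓ u).component < (ℓ v).component ∧ l' = Label.join (ℓ u).component u i ∧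
    ∀ i' u', (i', u', v) ∈ D → al u' = true → (ℓ u').active = true →
      (ℓ u).component ≤ (ℓ u').component

/-- No search with a smaller root reaches `v`, whose record changes from `ℓ v` to `l'`. -/
structure Advances (D : List (I × V × V)) (al : V → Bool) (ℓ : V → Label V I) (v : V)
    (l' : Label V I) : Prop where
  le : ∀ i u, (i, u, v) ∈ D → al u = true → (ℓ u).active = true →
    (ℓ v).component ≤ (ℓ u).component
  component : l'.component = (ℓ v).component
  parentItem : l'.parentItem = (ℓ v).parentItem
  active : l'.active = false
  pending : l'.pending = true ↔ (ℓ v).pending = true ∨ (ℓ v).active = true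
  complete : l'.complete = true ↔ (ℓ v).complete = true ∨ l'.pending = true ∧
    (∀ i u, (i, u, v) ∈ D → al u = true → (ℓ u).component = (ℓ v).component) ∧
    ∀ i u, (i, u, v) ∈ D → al u = true → (ℓ u).parentItem = some i → (ℓ u).complete = true
  finished : l'.finished = true ↔ (ℓ v).finished = true ∨ l'.complete = true ∧
    ((ℓ v).parentItem = none ∨ ∃ i u, (i, u, v) ∈ D ∧ al u = true ∧
      (ℓ v).parentItem = some i ∧ (ℓ u).finished = true)

/-- This is the interface to the graph-theoretic analysis, which no longer mentions registers: the
case distinction is whether the smallest pushed root beats the present one. -/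
theorem IsState.joins_or_advances {D : List (I × V × V)} {al al' : V → Bool} {ℓ : V → Label V I}
    {X : List (Value V I)} (h : IsState D al al' ℓ X) {v : V} (hv : v ∈ verts D)
    (hal : al v = true) (hal' : al' v = true) :
    Joins D al ℓ v (update (registers v (inbox X v)) (ℓ v)) ∨
      Advances D al ℓ v (update (registers v (inbox X v)) (ℓ v)) := by
  by_cases hq : ∃ q, (registers v (inbox X v)).push = some q ∧ (ofLex q).1 < (ℓ v).component
  · obtain ⟨q, hq, hlt⟩ := hq
    left
    obtain ⟨i, u, h1, h2, h3, rfl⟩ := h.registers_push_mem hv hal hal' hq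
    refine ⟨i, u, h1, h2, h3, hlt, ?_, fun i' u' h1' h2' h3' => ?_⟩
    · simp only [update, hq]
      rw [if_pos hlt]
      rfl
    · obtain ⟨q', hq', hle⟩ := h.registers_push_le hv hal hal' h1' h2' h3'
      rw [hq] at hq'
      cases hq'
      exact hle
  · right
    have hu : update (registers v (inbox X v)) (ℓ v) = advance (registers v (inbox X v)) (ℓ v) := by
      rw [update]
      split
      · rfl
      · rename_i q hq'
        rw [if_neg fun hlt => hq ⟨q, hq', hlt⟩]
    rw [hu]
    refine ⟨fun i u h1 h2 h3 => ?_, rfl, rfl, rfl, ?_, ?_, ?_⟩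
    · obtain ⟨q, hq', hle⟩ := h.registers_push_le hv hal hal' h1 h2 h3
      by_contra hlt
      exact hq ⟨q, hq', hle.trans_lt (not_le.1 hlt)⟩
    · simp [advance]
    · simp only [advance, Bool.or_eq_true, Bool.and_eq_true,
        h.registers_agree hv hal hal', h.registers_childrenComplete hv hal hal', and_assoc]
    · simp only [advance, Bool.or_eq_true, Bool.and_eq_true,
        h.registers_parentFinished hv hal hal', Option.isNone_iff_eq_none]

/-- The evolution of the records `ℓ s` of the vertices in `al s`, in the iterations `s = 0, 1, …` -/
structure Evolution (D : List (I × V × V)) (al : ℕ → V → Bool) (ℓ : ℕ → V → Label V I) :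
    Prop where
  alive_zero : ∀ v, al 0 v = true ↔ v ∈ verts D
  label_zero : ∀ v, ℓ 0 v = Label.init v
  step : ∀ s v, al s v = true → Joins D (al s) (ℓ s) v (ℓ (s + 1) v) ∨
    Advances D (al s) (ℓ s) v (ℓ (s + 1) v)
  alive_succ : ∀ s v, al (s + 1) v = true ↔ al s v = true ∧ ¬((ℓ (s + 1) v).finished = true ∧
    ∀ i u, (i, u, v) ∈ D → al s u = true → (ℓ s u).parentItem = some i →
      (ℓ s u).finished = true)

theorem arcs_swap_perm (E : List (I × V × V)) :
    ((arcs E).map fun a => (a.1, a.2.2, a.2.1)).Perm (arcs E) := by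
  induction E with
  | nil => simp [arcs]
  | cons e E ih =>
    simp only [arcs, List.flatMap_cons, List.map_append] at ih ⊢
    exact List.Perm.append (List.Perm.swap _ _ _) ih

/-- The value that represents an edge in the input. -/
def toValue (e : I × V × V) : Value V I := .edge e.1 e.2.1 e.2.2

theorem run_one_perm (E : List (I × V × V)) :
    ((algorithm V I).run (E.map toValue) 1).Perm
      ((arcs E).map fun a => .half a.1 a.2.1 a.2.2) := by
  have hX : ∀ x ∈ E.map toValue, ∃ e, x = toValue e := by
    intro x hx
    obtain ⟨e, _, rfl⟩ := List.mem_map.1 hx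
    exact ⟨e, rfl⟩
  refine (phase_perm _).trans ?_
  have h1 : ((keys (E.map toValue)).flatMap fun k =>
      (close k (registers k (inbox (E.map toValue) k))).filterMap Sum.getLeft?) = [] := by
    rw [List.flatMap_eq_nil_iff]
    intro k _
    have h2 : (registers k (inbox (E.map toValue) k)).self = none := by
      rw [registers, foldl_scan_self, foldl_load_self_of_forall_ne]
      · rfl
      · intro v l hl
        obtain ⟨e, he⟩ := hX _ (List.mem_filter.1 hl).1
        cases he
    have h3 : (registers k (inbox (E.map toValue) k)).fresh = false := by
      rw [registers, foldl_scan_fresh, ← Bool.not_eq_true, foldl_load_fresh]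
      rintro (h | ⟨i, v, w, hl⟩)
      · simp [Registers.start] at h
      · obtain ⟨e, he⟩ := hX _ (List.mem_filter.1 hl).1
        cases he
    simp [close, h2, h3]
  rw [h1, List.append_nil, List.flatMap_map, arcs, List.map_flatMap]
  exact List.Perm.of_eq rfl

/-- No message has been dropped yet, hence the trivial filter on the targets. -/
theorem run_two_isState (E : List (I × V × V)) :
    IsState (arcs E) (fun v => decide (v ∈ verts (arcs E))) (fun _ => true) Label.init
      ((algorithm V I).run (E.map toValue) 2) := by
  have hr : (algorithm V I).run (E.map toValue) 2 =
      (algorithm V I).phase ((algorithm V I).run (E.map toValue) 1) := rfl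
  rw [hr]
  set X := (algorithm V I).run (E.map toValue) 1 with hX
  have hp : X.Perm ((arcs E).map fun a => .half a.1 a.2.1 a.2.2) := run_one_perm E
  have hmem : ∀ x, x ∈ X ↔ ∃ a ∈ arcs E, Value.half a.1 a.2.1 a.2.2 = x := by
    intro x
    rw [hp.mem_iff, List.mem_map]
  refine (phase_perm X).trans (List.perm_append_comm.trans (List.Perm.append ?_ ?_))
  · have h1 : ((keys X).flatMap fun k =>
        (close k (registers k (inbox X k))).filterMap Sum.getLeft?) =
        (keys X).map fun k => Value.node k (Label.init k) := by
      rw [List.map_eq_flatMap]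
      refine List.flatMap_congr fun k hk => ?_
      have h2 : (registers k (inbox X k)).self = none := by
        rw [registers, foldl_scan_self, foldl_load_self_of_forall_ne]
        · rfl
        · intro v l hl
          obtain ⟨e, _, he⟩ := (hmem _).1 (List.mem_filter.1 hl).1
          cases he
      have h3 : (registers k (inbox X k)).fresh = true := by
        rw [registers, foldl_scan_fresh, foldl_load_fresh]
        obtain ⟨x, hx, rfl⟩ := mem_keys.1 hk
        obtain ⟨a, _, rfl⟩ := (hmem _).1 hx
        exact Or.inr ⟨a.1, a.2.1, a.2.2, by simp [inbox, hx]⟩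
      simp [close, h2, h3]
    rw [h1]
    refine List.Perm.map _ ((List.perm_ext_iff_of_nodup (List.nodup_dedup _)
      ((List.nodup_dedup _).filter _)).2 fun v => ?_)
    change v ∈ keys X ↔ v ∈ (verts (arcs E)).filter _
    rw [mem_keys, List.mem_filter, decide_eq_true_eq, and_self, mem_verts]
    constructor
    · rintro ⟨x, hx, rfl⟩
      obtain ⟨a, ha, rfl⟩ := (hmem _).1 hx
      exact ⟨a.1, a.2.2, ha⟩
    · rintro ⟨i, w, h⟩
      exact ⟨_, (hmem _).2 ⟨_, h, rfl⟩, rfl⟩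
  · refine (List.Perm.flatMap_right _ hp).trans (List.Perm.of_eq ?_)
    rw [List.flatMap_map, List.map_eq_flatMap]
    have h4 : ((arcs E).filter fun a => decide (a.2.1 ∈ verts (arcs E)) && true) = arcs E := by
      rw [List.filter_eq_self]
      intro a ha
      simpa using mem_verts.2 ⟨a.1, a.2.2, ha⟩
    rw [h4]
    exact List.flatMap_congr fun a _ => rfl

/-- The vertices that are processed after `s` iterations, and their records. -/
def evolve (E : List (I × V × V)) : ℕ → (V → Bool) × (V → Label V I)
  | 0 => (fun v => decide (v ∈ verts (arcs E)), Label.init)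
  | s + 1 =>
    let r := fun v => registers v (inbox ((algorithm V I).run (E.map toValue) (s + 2)) v)
    let ℓ' := fun v => update (r v) ((evolve E s).2 v)
    (fun v => (evolve E s).1 v && !isFinal (r v) (ℓ' v), ℓ')

theorem mem_verts_of_evolve (E : List (I × V × V)) (s : ℕ) {v : V}
    (h : (evolve E s).1 v = true) : v ∈ verts (arcs E) := by
  induction s with
  | zero => simpa [evolve] using h
  | succ s ih =>
    refine ih ?_
    simp only [evolve, Bool.and_eq_true] at h
    exact h.1

/-- After the first iteration, `al'` is the set of vertices processed one iteration earlier: a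
message may be addressed to a vertex that has just become final. Later only the inclusion matters.
-/
theorem exists_isState (E : List (I × V × V)) (s : ℕ) :
    ∃ al' : V → Bool, (∀ v, (evolve E s).1 v = true → al' v = true) ∧
      IsState (arcs E) (evolve E s).1 al' (evolve E s).2
        ((algorithm V I).run (E.map toValue) (s + 2)) := by
  induction s with
  | zero => exact ⟨fun _ => true, fun _ _ => rfl, run_two_isState E⟩
  | succ s ih =>
    obtain ⟨al', hle, h⟩ := ih
    refine ⟨(evolve E s).1, fun v hv => ?_, ?_⟩
    · simp only [evolve, Bool.and_eq_true] at hv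
      exact hv.1
    · have h1 := h.phase (arcs_swap_perm E) (fun v => mem_verts_of_evolve E s) hle
      have h2 : (algorithm V I).run (E.map toValue) (s + 1 + 2) =
          (algorithm V I).phase ((algorithm V I).run (E.map toValue) (s + 2)) :=
        Function.iterate_succ_apply' _ _ _
      rw [h2]
      exact h1

theorem evolution (E : List (I × V × V)) :
    Evolution (arcs E) (fun s => (evolve E s).1) (fun s => (evolve E s).2) where
  alive_zero v := by simp [evolve]
  label_zero v := rfl
  step s v hv := by
    obtain ⟨al', hle, h⟩ := exists_isState E s
    exact h.joins_or_advances (mem_verts_of_evolve E s hv) hv (hle v hv)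
  alive_succ s v := by
    obtain ⟨al', hle, h⟩ := exists_isState E s
    have h1 : (evolve E (s + 1)).1 v = true ↔ (evolve E s).1 v = true ∧
        ¬isFinal (registers v (inbox ((algorithm V I).run (E.map toValue) (s + 2)) v))
          ((evolve E (s + 1)).2 v) = true := by
      simp [evolve]
    rw [h1]
    refine and_congr_right fun hv => not_congr ?_
    rw [isFinal, Bool.and_eq_true,
      h.registers_childrenFinished (mem_verts_of_evolve E s hv) hv (hle v hv)]

theorem length_run_le (E : List (I × V × V)) (s : ℕ) :
    ((algorithm V I).run (E.map toValue) (s + 2)).length ≤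
      2 * ((arcs E).filter fun a => (evolve E s).1 a.2.1).length := by
  obtain ⟨al', -, h⟩ := exists_isState E s
  exact h.length_le

end CuckooBFS

/-! ### Distances in a simple graph. -/

namespace SimpleGraph

variable {V : Type*} {G : SimpleGraph V}

theorem Reachable.dist_le_add_one {d u v : V} (h : G.Reachable d u) (huv : G.Adj u v) :
    G.dist d v ≤ G.dist d u + 1 := by
  obtain ⟨p, hp⟩ := h.exists_walk_length_eq_dist
  simpa [← hp] using dist_le (p.concat huv)

/-- The witness is the neighbor of `v` on a shortest walk. -/
theorem Reachable.exists_adj_dist_add_one_eq {d v : V} (h : G.Reachable d v) (hne : d ≠ v) :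
    ∃ u, G.Adj u v ∧ G.Reachable d u ∧ G.dist d u + 1 = G.dist d v := by
  obtain ⟨p, hp⟩ := h.symm.exists_walk_length_eq_dist
  cases p with
  | nil => exact absurd rfl hne
  | @cons _ u _ hvu q =>
    have hu : G.Reachable d u := q.reachable.symm
    refine ⟨u, hvu.symm, hu, le_antisymm ?_ (hu.dist_le_add_one hvu.symm)⟩
    rw [dist_comm (v := v), ← hp, Walk.length_cons, dist_comm]
    exact Nat.add_le_add_right (dist_le q) 1

end SimpleGraph

/-! ### The competing searches inside one component. -/

namespace CuckooBFS

variable {V I : Type*} [LinearOrder V] [LinearOrder I]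

/-- The evolution of the records in a multigraph with simplification `G`, and the smallest vertex
`M` of one of its components. -/
structure ComponentEvolution (D : List (I × V × V)) (al : ℕ → V → Bool) (ℓ : ℕ → V → Label V I)
    (G : SimpleGraph V) (M : V) : Prop extends Evolution D al ℓ where
  adj_iff : ∀ u v, G.Adj u v ↔ ∃ i, (i, u, v) ∈ D
  symm : ∀ i u v, (i, u, v) ∈ D → (i, v, u) ∈ D
  unique : ∀ i u u' v, (i, u, v) ∈ D → (i, u', v) ∈ D → u = u'
  alive_of_reachable : ∀ v, G.Reachable M v → al 0 v = true
  le_of_reachable : ∀ v, G.Reachable M v → M ≤ v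

/-- All vertices of the component of `M` are processed in the iterations before `s`. -/
def AllAlive (al : ℕ → V → Bool) (G : SimpleGraph V) (M : V) (s : ℕ) : Prop :=
  ∀ s' < s, ∀ v, G.Reachable M v → al s' v = true

theorem AllAlive.mono {al : ℕ → V → Bool} {G : SimpleGraph V} {M : V} {s s' : ℕ}
    (h : AllAlive al G M s) (hs : s' ≤ s) : AllAlive al G M s' :=
  fun t ht => h t (ht.trans_le hs)

namespace ComponentEvolution

variable {D : List (I × V × V)} {al : ℕ → V → Bool} {ℓ : ℕ → V → Label V I} {G : SimpleGraph V}
  {M : V} (H : ComponentEvolution D al ℓ G M)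

include H

theorem adj {i : I} {u v : V} (h : (i, u, v) ∈ D) : G.Adj u v := (H.adj_iff u v).2 ⟨i, h⟩

theorem reachable_of_mem {i : I} {u v d : V} (h : (i, u, v) ∈ D) (hv : G.Reachable d v) :
    G.Reachable d u := hv.trans (H.adj h).symm.reachable

theorem component_succ_le {s : ℕ} {v : V} (h : al s v = true) :
    (ℓ (s + 1) v).component ≤ (ℓ s v).component := by
  rcases H.step s v h with ⟨i, u, _, _, _, hlt, he, _⟩ | h
  · rw [he]; exact hlt.le
  · exact h.component.le

theorem component_anti {s t : ℕ} (hA : AllAlive al G M t) (hst : s ≤ t) {v : V}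
    (hv : G.Reachable M v) : (ℓ t v).component ≤ (ℓ s v).component := by
  induction t, hst using Nat.le_induction with
  | base => exact le_rfl
  | succ t hst ih =>
    exact (H.component_succ_le (hA t t.lt_succ_self v hv)).trans (ih (hA.mono t.le_succ))

/-- The name of a root travels along edges, at most one edge per iteration. -/
theorem reachable_component {s : ℕ} (hA : AllAlive al G M s) {v : V} (hv : G.Reachable M v) :
    G.Reachable (ℓ s v).component v ∧ G.dist (ℓ s v).component v ≤ s := by
  induction s generalizing v with
  | zero => simp [H.label_zero, Label.init]
  | succ s ih =>
    have hA' := hA.mono s.le_succ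
    rcases H.step s v (hA s s.lt_succ_self v hv) with ⟨i, u, hm, _, _, _, he, _⟩ | h
    · rw [he]
      obtain ⟨h1, h2⟩ := ih hA' (H.reachable_of_mem hm hv)
      exact ⟨h1.trans (H.adj hm).reachable,
        (h1.dist_le_add_one (H.adj hm)).trans (Nat.add_le_add_right h2 1)⟩
    · rw [h.component]
      exact ⟨(ih hA' hv).1, (ih hA' hv).2.trans s.le_succ⟩

theorem le_component {s : ℕ} (hA : AllAlive al G M s) {v : V} (hv : G.Reachable M v) :
    M ≤ (ℓ s v).component :=
  H.le_of_reachable _ (hv.trans (H.reachable_component hA hv).1.symm)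

/-- An inactive vertex kept its component in the last iteration, so comparisons with it can be moved
back in time. -/
theorem active_or {s : ℕ} (hA : AllAlive al G M s) {v : V} (hv : G.Reachable M v) :
    (ℓ s v).active = true ∨
      ∃ s', s = s' + 1 ∧ (ℓ s' v).component = (ℓ s v).component := by
  cases s with
  | zero => left; rw [H.label_zero]; rfl
  | succ s =>
    rcases H.step s v (hA s s.lt_succ_self v hv) with ⟨i, u, _, _, _, _, he, _⟩ | h
    · left; rw [he]; rfl
    · exact Or.inr ⟨s, rfl, h.component.symm⟩

/-- An active `u` pushes its search to `v` right now; an inactive one had the same component one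
iteration ago, and the induction hypothesis applies. -/
theorem component_succ_le_of_adj {s : ℕ} (hA : AllAlive al G M (s + 1)) {u v : V}
    (hv : G.Reachable M v) (huv : G.Adj u v) :
    (ℓ (s + 1) v).component ≤ (ℓ s u).component := by
  have hu : G.Reachable M u := hv.trans huv.symm.reachable
  induction s with
  | zero =>
    obtain ⟨i, hm⟩ := (H.adj_iff u v).1 huv
    have ha : (ℓ 0 u).active = true := by rw [H.label_zero]; rfl
    have hu' := hA 0 zero_lt_one u hu
    rcases H.step 0 v (hA 0 zero_lt_one v hv) with ⟨i', u', _, _, _, _, he, hle⟩ | h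
    · rw [he]; exact hle i u hm hu' ha
    · rw [h.component]; exact h.le i u hm hu' ha
  | succ s ih =>
    have hA' : AllAlive al G M (s + 1) := hA.mono (s + 1).le_succ
    have hv' := hA (s + 1) (s + 1).lt_succ_self v hv
    rcases H.active_or hA' hu with ha | ⟨s', hs, hc⟩
    · obtain ⟨i, hm⟩ := (H.adj_iff u v).1 huv
      have hu' := hA (s + 1) (s + 1).lt_succ_self u hu
      rcases H.step (s + 1) v hv' with ⟨i', u', _, _, _, _, he, hle⟩ | h
      · rw [he]; exact hle i u hm hu' ha
      · rw [h.component]; exact h.le i u hm hu' ha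
    · obtain rfl : s = s' := by omega
      rw [← hc]
      exact (H.component_succ_le hv').trans (ih hA')

/-- The wave from `d` advances one edge per iteration along a shortest path, unless a smaller root
overtakes it. -/
theorem component_le_of_dist_le {s : ℕ} (hA : AllAlive al G M s) {d v : V}
    (hv : G.Reachable M v) (hd : G.Reachable d v) (hs : G.dist d v ≤ s) :
    (ℓ s v).component ≤ d := by
  induction s generalizing v with
  | zero =>
    have : d = v := (hd.dist_eq_zero_iff).1 (by omega)
    simp [H.label_zero, Label.init, this]
  | succ s ih =>
    have hA' := hA.mono s.le_succ
    by_cases hs' : G.dist d v ≤ s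
    · exact (H.component_succ_le (hA s s.lt_succ_self v hv)).trans (ih hA' hv hd hs')
    · have hne : d ≠ v := by
        rintro rfl
        simp at hs'
      obtain ⟨u, huv, hdu, hu⟩ := hd.exists_adj_dist_add_one_eq hne
      exact (H.component_succ_le_of_adj hA hv huv).trans
        (ih hA' (hv.trans huv.symm.reachable) hdu (by omega))

/-- Were the vertex closer to its root, that root or a smaller one would have reached it before, and
joining could not have lowered its component. -/
theorem dist_of_active {s : ℕ} (hA : AllAlive al G M s) {v : V} (hv : G.Reachable M v)
    (ha : (ℓ s v).active = true) : G.dist (ℓ s v).component v = s := by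
  induction s generalizing v with
  | zero => simp [H.label_zero, Label.init]
  | succ s ih =>
    have hA' := hA.mono s.le_succ
    refine le_antisymm (H.reachable_component hA hv).2 ?_
    rcases H.step s v (hA s s.lt_succ_self v hv) with ⟨i, u, hm, _, hau, hlt, he, _⟩ | h
    · by_contra hcon
      have h1 := H.component_le_of_dist_le hA' hv (H.reachable_component hA hv).1 (by omega)
      rw [he] at h1
      exact absurd hlt (not_lt.2 h1)
    · rw [h.active] at ha
      cases ha

theorem component_eq_of_parentItem_eq_none {s : ℕ} (hA : AllAlive al G M s) {v : V}
    (hv : G.Reachable M v) (hp : (ℓ s v).parentItem = none) : (ℓ s v).component = v := by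
  induction s with
  | zero => simp [H.label_zero, Label.init]
  | succ s ih =>
    rcases H.step s v (hA s s.lt_succ_self v hv) with ⟨i, u, _, _, _, _, he, _⟩ | h
    · rw [he] at hp; cases hp
    · rw [h.component]
      rw [h.parentItem] at hp
      exact ih (hA.mono s.le_succ) hp

/-- The parent was active when it was joined and the child right after, so `dist_of_active` reads
both distances off the clock. Later iterations without a join keep component and parent. -/
theorem exists_parent {s : ℕ} (hA : AllAlive al G M s) {v : V}
    (hv : G.Reachable M v) {i : I} (hp : (ℓ s v).parentItem = some i) :
    ∃ u, (i, u, v) ∈ D ∧ G.dist (ℓ s v).component u + 1 = G.dist (ℓ s v).component v := by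
  induction s with
  | zero => simp [H.label_zero, Label.init] at hp
  | succ s ih =>
    have hA' := hA.mono s.le_succ
    rcases H.step s v (hA s s.lt_succ_self v hv) with ⟨i', u, hm, _, hau, _, he, _⟩ | h
    · have hav : (ℓ (s + 1) v).active = true := by rw [he]; rfl
      have h1 := H.dist_of_active hA hv hav
      have h2 := H.dist_of_active hA' (H.reachable_of_mem hm hv) hau
      rw [he] at hp h1
      cases hp
      exact ⟨u, hm, by rw [he]; simp only [Label.join] at h1 ⊢; omega⟩
    · rw [h.component]
      rw [h.parentItem] at hp
      exact ih hA' hp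

theorem root {s : ℕ} (hA : AllAlive al G M s) :
    (ℓ s M).component = M ∧ (ℓ s M).parentItem = none := by
  induction s with
  | zero => simp [H.label_zero, Label.init]
  | succ s ih =>
    have hA' := hA.mono s.le_succ
    obtain ⟨h1, h2⟩ := ih hA'
    rcases H.step s M (hA s s.lt_succ_self M (.refl M)) with ⟨i, u, hm, _, _, hlt, _⟩ | h
    · rw [h1] at hlt
      exact absurd hlt (not_lt.2 (H.le_component hA' (H.reachable_of_mem hm (.refl M))))
    · rw [h.component, h.parentItem]
      exact ⟨h1, h2⟩

/-- What a complete vertex has verified cannot become outdated: a neighbor that moved to a smaller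
search would be active, and would have drawn `v` along. -/
theorem neighbors_of_complete {s : ℕ} (hA : AllAlive al G M (s + 1)) {v : V}
    (hv : G.Reachable M v) (hc : (ℓ (s + 1) v).complete = true) {i : I} {u : V}
    (hm : (i, u, v) ∈ D) : (ℓ s u).component = (ℓ (s + 1) v).component ∧
      ((ℓ s u).parentItem = some i → (ℓ s u).complete = true) := by
  induction s with
  | zero =>
    have hu' := hA 0 zero_lt_one u (H.reachable_of_mem hm hv)
    rcases H.step 0 v (hA 0 zero_lt_one v hv) with ⟨i', u', _, _, _, _, he, _⟩ | h
    · rw [he] at hc; cases hc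
    · rcases h.complete.1 hc with h1 | ⟨_, h1, h2⟩
      · rw [H.label_zero] at h1; cases h1
      · rw [h.component]
        exact ⟨h1 i u hm hu', h2 i u hm hu'⟩
  | succ s ih =>
    have hA' : AllAlive al G M (s + 1) := hA.mono (s + 1).le_succ
    have hu : G.Reachable M u := H.reachable_of_mem hm hv
    have hu' := hA (s + 1) (s + 1).lt_succ_self u hu
    rcases H.step (s + 1) v (hA (s + 1) (s + 1).lt_succ_self v hv) with
      ⟨i', u', _, _, _, _, he, _⟩ | h
    · rw [he] at hc; cases hc
    · rcases h.complete.1 hc with h1 | ⟨_, h1, h2⟩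
      · obtain ⟨h3, h4⟩ := ih hA' h1
        rcases H.step s u (hA' s s.lt_succ_self u hu) with ⟨i', u', _, _, _, hlt, he, _⟩ | h'
        · have h5 : (ℓ (s + 1) u).active = true := by rw [he]; rfl
          have h6 := h.le i u hm hu' h5
          rw [he] at h6
          exact absurd ((h6.trans_lt hlt).trans_eq h3) (lt_irrefl _)
        · rw [h.component, h'.component, h'.parentItem]
          exact ⟨h3, fun hp => h'.complete.2 (Or.inl (h4 hp))⟩
      · rw [h.component]
        exact ⟨h1 i u hm hu', h2 i u hm hu'⟩

/-- Induction on the distance from the root. A complete vertex closer to `d` certifies that `w` was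
in the search `d` one iteration before; the parent of `w`, complete as well, certifies that `w` was
complete. -/
theorem complete_of_root_complete {t : ℕ} (hA : AllAlive al G M t) {d : V}
    (hd : G.Reachable M d) (hcd : (ℓ t d).component = d) (hc : (ℓ t d).complete = true) (k : ℕ)
    {w : V} (hw : G.Reachable d w) (hk : G.dist d w = k) :
    ∃ s, s + k = t ∧ (ℓ s w).component = d ∧ (ℓ s w).complete = true := by
  induction k generalizing w with
  | zero =>
    obtain rfl := (hw.dist_eq_zero_iff).1 hk
    exact ⟨t, rfl, hcd, hc⟩
  | succ k ih =>
    have hne : d ≠ w := by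
      rintro rfl
      simp at hk
    obtain ⟨v, hvw, hdv, hv⟩ := hw.exists_adj_dist_add_one_eq hne
    obtain ⟨s, hs, h1, h2⟩ := ih hdv (by omega)
    obtain ⟨i, hm⟩ := (H.adj_iff v w).1 hvw
    cases s with
    | zero => rw [H.label_zero] at h2; cases h2
    | succ s =>
      have hA' : AllAlive al G M (s + 1) := hA.mono (by omega)
      have hA'' : AllAlive al G M s := hA.mono (by omega)
      have h3 := (H.neighbors_of_complete hA' (hd.trans hdv) h2 (H.symm _ _ _ hm)).1
      rw [h1] at h3
      have hw' : G.Reachable M w := hd.trans hw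
      cases hp : (ℓ s w).parentItem with
      | none => exact absurd (h3.symm.trans (H.component_eq_of_parentItem_eq_none hA'' hw' hp)) hne
      | some j =>
        -- The parent `v'` may differ from `v`, but it too has distance `k` from `d`, so the
        -- induction hypothesis covers it.
        obtain ⟨v', hm', hv'⟩ := H.exists_parent hA'' hw' hp
        rw [h3] at hv'
        have hdv' : G.Reachable d v' := H.reachable_of_mem hm' hw
        obtain ⟨s', hs', h4, h5⟩ := ih hdv' (by omega)
        obtain rfl : s' = s + 1 := by omega
        exact ⟨s, by omega, h3,
          (H.neighbors_of_complete hA' (hd.trans hdv') h5 (H.symm _ _ _ hm')).2 hp⟩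

/-- The finished flag can only originate at a complete root, and vertices leave only when finished.
So nothing happens prematurely while `M` is incomplete. -/
theorem not_finished {s : ℕ} (hM : ∀ s' ≤ s, (ℓ s' M).complete = false) :
    AllAlive al G M (s + 1) ∧ ∀ v, G.Reachable M v → (ℓ s v).finished = false := by
  induction s with
  | zero =>
    refine ⟨fun s' hs' v hv => ?_, fun v hv => by rw [H.label_zero]; rfl⟩
    obtain rfl : s' = 0 := by omega
    exact H.alive_of_reachable v hv
  | succ s ih =>
    obtain ⟨hA, hf⟩ := ih fun s' hs' => hM s' (by omega)
    have key : ∀ v, G.Reachable M v → (ℓ (s + 1) v).finished = false := by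
      intro v hv
      rcases H.step s v (hA s s.lt_succ_self v hv) with ⟨i', u', _, _, _, _, he, _⟩ | h
      · rw [he]; rfl
      · by_contra hcon
        rw [Bool.not_eq_false] at hcon
        rcases h.finished.1 hcon with h1 | ⟨h1, h2 | ⟨i, u, hm, _, _, h2⟩⟩
        · simp [hf v hv] at h1
        · rw [← h.parentItem] at h2
          have h3 := H.component_eq_of_parentItem_eq_none hA hv h2
          -- A complete root `v`, whichever it is, forces `M` to have been complete, against `hM`.
          obtain ⟨t, ht, h4, h5⟩ := H.complete_of_root_complete hA hv h3 h1 _ hv.symm rfl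
          rw [hM t (by omega)] at h5
          cases h5
        · simp [hf u (H.reachable_of_mem hm hv)] at h2
    refine ⟨fun s' hs' v hv => ?_, key⟩
    rcases Nat.lt_succ_iff_lt_or_eq.1 hs' with h | rfl
    · exact hA s' h v hv
    · exact (H.alive_succ s v).2 ⟨hA s s.lt_succ_self v hv, by simp [key v hv]⟩

theorem active_or_pending {s : ℕ} (hA : AllAlive al G M s) {v : V} (hv : G.Reachable M v) :
    (ℓ s v).pending = true ∨ (ℓ s v).active = true := by
  induction s with
  | zero => right; rw [H.label_zero]; rfl
  | succ s ih =>
    rcases H.step s v (hA s s.lt_succ_self v hv) with ⟨i', u', _, _, _, _, he, _⟩ | h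
    · right; rw [he]; rfl
    · left; exact h.pending.2 (ih (hA.mono s.le_succ))

theorem component_eq {e s : ℕ} (he : ∀ v, G.Reachable M v → G.dist M v ≤ e) (hs : e ≤ s)
    (hA : AllAlive al G M s) {v : V} (hv : G.Reachable M v) : (ℓ s v).component = M :=
  le_antisymm (H.component_le_of_dist_le hA hv hv ((he v hv).trans hs)) (H.le_component hA hv)

/-- From time `e` on there is only the search from `M`, and children lie one level below their
parents. Completeness therefore climbs one level per iteration, starting at depth `e`. -/
theorem complete_of_le {e : ℕ} (he : ∀ v, G.Reachable M v → G.dist M v ≤ e) (j : ℕ)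
    (hA : AllAlive al G M (e + 1 + j)) {v : V} (hv : G.Reachable M v)
    (hj : e ≤ G.dist M v + j) : (ℓ (e + 1 + j) v).complete = true := by
  induction j generalizing v with
  | zero =>
    have hA' : AllAlive al G M e := hA.mono (by omega)
    rcases H.step e v (hA e (by omega) v hv) with ⟨i', u', hm, _, _, hlt, _⟩ | h
    · rw [H.component_eq he le_rfl hA' hv,
        H.component_eq he le_rfl hA' (H.reachable_of_mem hm hv)] at hlt
      exact absurd hlt (lt_irrefl _)
    · refine h.complete.2 (Or.inr ⟨h.pending.2 (H.active_or_pending hA' hv),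
        fun i u hm _ => ?_, fun i u hm _ hp => ?_⟩)
      · rw [H.component_eq he le_rfl hA' hv,
          H.component_eq he le_rfl hA' (H.reachable_of_mem hm hv)]
      -- At depth `e` there are no children: one would have distance `e + 1` from `M`.
      · have hu := H.reachable_of_mem hm hv
        obtain ⟨v', hm', h1⟩ := H.exists_parent hA' hu hp
        rw [H.component_eq he le_rfl hA' hu, H.unique _ _ _ _ hm' (H.symm _ _ _ hm)] at h1
        have := he u hu
        omega
  | succ j ih =>
    have hA' : AllAlive al G M (e + 1 + j) := hA.mono (by omega)
    have hle : e ≤ e + 1 + j := by omega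
    rcases H.step (e + 1 + j) v (hA (e + 1 + j) (by omega) v hv) with
      ⟨i', u', hm, _, _, hlt, _⟩ | h
    · rw [H.component_eq he hle hA' hv,
        H.component_eq he hle hA' (H.reachable_of_mem hm hv)] at hlt
      exact absurd hlt (lt_irrefl _)
    · refine h.complete.2 (Or.inr ⟨h.pending.2 (H.active_or_pending hA' hv),
        fun i u hm _ => ?_, fun i u hm _ hp => ?_⟩)
      · rw [H.component_eq he hle hA' hv,
          H.component_eq he hle hA' (H.reachable_of_mem hm hv)]
      · have hu := H.reachable_of_mem hm hv
        obtain ⟨v', hm', h1⟩ := H.exists_parent hA' hu hp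
        rw [H.component_eq he hle hA' hu, H.unique _ _ _ _ hm' (H.symm _ _ _ hm)] at h1
        exact ih hA' hu (by omega)

/-- The first iteration after which the root is complete. -/
theorem exists_complete {e : ℕ} (he : ∀ v, G.Reachable M v → G.dist M v ≤ e) :
    ∃ T ≤ 2 * e, AllAlive al G M (T + 1) ∧ (ℓ (T + 1) M).complete = true := by
  classical
  by_cases hex : ∃ s, (ℓ s M).complete = true ∧ s ≤ 2 * e + 1
  · have h1 := Nat.find_spec hex
    have h2 : ∀ s < Nat.find hex, ¬((ℓ s M).complete = true ∧ s ≤ 2 * e + 1) :=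
      fun s hs => Nat.find_min hex hs
    obtain ⟨T, hT⟩ : ∃ T, Nat.find hex = T + 1 := by
      refine Nat.exists_eq_succ_of_ne_zero fun h0 => ?_
      rw [h0, H.label_zero] at h1
      cases h1.1
    rw [hT] at h1 h2
    refine ⟨T, by omega, (H.not_finished fun s hs => ?_).1, h1.1⟩
    have := h2 s (by omega)
    rw [← Bool.not_eq_true]
    exact fun h => this ⟨h, by omega⟩
  · have h1 : ∀ s' ≤ 2 * e + 1, (ℓ s' M).complete = false := fun s hs => by
      rw [← Bool.not_eq_true]
      exact fun h => hex ⟨s, h, hs⟩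
    have hA := (H.not_finished h1).1
    -- Taking `j = e` reaches depth `0`, that is `M` itself, at time `2 * e + 1`.
    have h2 := H.complete_of_le he e (hA.mono (by omega)) (.refl M) (by omega)
    rw [h1 _ (by omega)] at h2
    cases h2

theorem alive_anti {s t : ℕ} (hst : s ≤ t) {v : V} (h : al t v = true) : al s v = true := by
  induction t, hst using Nat.le_induction with
  | base => exact h
  | succ t hst ih => exact ih ((H.alive_succ t v).1 h).1

section

variable {T : ℕ} (hA : AllAlive al G M (T + 1)) (hc : (ℓ (T + 1) M).complete = true)

include hA hc

/-- When the root is about to become complete, all vertices belong to its search. -/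
theorem component_eq_of_complete {v : V} (hv : G.Reachable M v) : (ℓ T v).component = M := by
  have hA' := hA.mono T.le_succ
  obtain ⟨s, hs, h1, -⟩ := H.complete_of_root_complete hA (.refl M) (H.root hA).1 hc _ hv rfl
  by_cases hvM : v = M
  · rw [hvM]; exact (H.root hA').1
  -- Positive distance puts `s` at or before `T`, so monotonicity carries the component from `s` to
  -- `T`.
  · have := hv.pos_dist_of_ne (Ne.symm hvM)
    refine le_antisymm ?_ (H.le_component hA' hv)
    rw [← h1]
    exact H.component_anti hA' (by omega) hv

/-- Once the root is complete, all vertices belong to its search and keep their parents. -/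
theorem stable {s : ℕ} (hs : T ≤ s) {v : V} (hv : G.Reachable M v) (h : al s v = true) :
    (ℓ s v).component = M ∧ (ℓ s v).parentItem = (ℓ T v).parentItem := by
  induction s, hs using Nat.le_induction generalizing v with
  | base => exact ⟨H.component_eq_of_complete hA hc hv, rfl⟩
  | succ s hs ih =>
    have h' := ((H.alive_succ s v).1 h).1
    obtain ⟨h1, h2⟩ := ih hv h'
    rcases H.step s v h' with ⟨i, u, hm, hu, _, hlt, _⟩ | h3
    · rw [h1, (ih (H.reachable_of_mem hm hv) hu).1] at hlt
      exact absurd hlt (lt_irrefl _)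
    · rw [h3.component, h3.parentItem]
      exact ⟨h1, h2⟩

theorem advances {s : ℕ} (hs : T ≤ s) {v : V} (hv : G.Reachable M v) (h : al s v = true) :
    Advances D (al s) (ℓ s) v (ℓ (s + 1) v) := by
  rcases H.step s v h with ⟨i, u, hm, hu, _, hlt, _⟩ | h3
  · rw [(H.stable hA hc hs hv h).1, (H.stable hA hc hs (H.reachable_of_mem hm hv) hu).1] at hlt
    exact absurd hlt (lt_irrefl _)
  · exact h3

/-- Each vertex was complete in the search of `M` by time `T + 1`; only joining a smaller root would
clear the flag, and there is none. -/
theorem complete_succ {s : ℕ} (hs : T ≤ s) {v : V} (hv : G.Reachable M v) (h : al s v = true) :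
    (ℓ (s + 1) v).complete = true := by
  induction s, hs using Nat.le_induction with
  | base =>
    obtain ⟨s, hs, h1, h2⟩ := H.complete_of_root_complete hA (.refl M) (H.root hA).1 hc _ hv rfl
    obtain ⟨k, hk⟩ : ∃ k, T + 1 = s + k := ⟨_, hs.symm⟩
    have : ∀ r, s ≤ r → r ≤ T + 1 → (ℓ r v).component = M ∧ (ℓ r v).complete = true := by
      intro r hr
      induction r, hr using Nat.le_induction with
      | base => exact fun _ => ⟨h1, h2⟩
      | succ r hr ih =>
        intro hrT
        have hAr : AllAlive al G M r := hA.mono (by omega)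
        obtain ⟨h3, h4⟩ := ih (by omega)
        rcases H.step r v (hA r (by omega) v hv) with ⟨i, u, hm, hu, _, hlt, _⟩ | h5
        · rw [h3] at hlt
          exact absurd hlt (not_lt.2 (H.le_component hAr (H.reachable_of_mem hm hv)))
        · rw [h5.component]
          exact ⟨h3, h5.complete.2 (Or.inl h4)⟩
    exact (this (T + 1) (by omega) le_rfl).2
  | succ s hs ih =>
    exact (H.advances hA hc (hs.trans s.le_succ) hv h).complete.2
      (Or.inl (ih ((H.alive_succ s v).1 h).1))

theorem finished_mono {s t : ℕ} (hs : T ≤ s) (hst : s ≤ t) {v : V} (hv : G.Reachable M v)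
    (hf : (ℓ s v).finished = true) (h : ∀ r < t, al r v = true) : (ℓ t v).finished = true := by
  induction t, hst using Nat.le_induction with
  | base => exact hf
  | succ t hst ih =>
    exact (H.advances hA hc (hs.trans hst) hv (h t t.lt_succ_self)).finished.2
      (Or.inl (ih fun r hr => h r (hr.trans t.lt_succ_self)))

/-- The finished flag descends the tree one level per iteration. The root sets it in the very
iteration in which it becomes complete, hence time `T + 1 + k`. -/
theorem finished_of_dist_eq (k : ℕ) {v : V} (hv : G.Reachable M v) (hk : G.dist M v = k)
    (h : al (T + 1 + k) v = true) : (ℓ (T + 1 + k) v).finished = true := by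
  induction k generalizing v with
  | zero =>
    obtain rfl := (hv.dist_eq_zero_iff).1 hk
    exact (H.advances hA hc le_rfl hv (hA T T.lt_succ_self _ hv)).finished.2
      (Or.inr ⟨hc, Or.inl (H.root (hA.mono T.le_succ)).2⟩)
  | succ k ih =>
    have hs : T ≤ T + 1 + k := by omega
    have h' : al (T + 1 + k) v = true := ((H.alive_succ (T + 1 + k) v).1 h).1
    have hcv := H.component_eq_of_complete hA hc hv
    have hA' := hA.mono T.le_succ
    cases hp : (ℓ T v).parentItem with
    | none =>
      rw [H.component_eq_of_parentItem_eq_none hA' hv hp] at hcv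
      rw [hcv, SimpleGraph.dist_self] at hk
      omega
    | some i =>
      obtain ⟨u, hm, hu⟩ := H.exists_parent hA' hv hp
      rw [hcv] at hu
      have hur : G.Reachable M u := H.reachable_of_mem hm hv
      by_cases hau : al (T + 1 + k) u = true
      · exact (H.advances hA hc hs hv h').finished.2 (Or.inr ⟨H.complete_succ hA hc hs hv h',
          Or.inr ⟨i, u, hm, hau, (H.stable hA hc hs hv h').2.trans hp, ih hur (by omega) hau⟩⟩)
      -- If the parent is already gone, it became final in some iteration `r`, and for that all of
      -- its children, `v` among them, had to be finished.
      · obtain ⟨r, hr, hr1, hr2⟩ : ∃ r, (T ≤ r ∧ r < T + 1 + k) ∧ al r u = true ∧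
            ¬al (r + 1) u = true := by
          by_contra hcon
          push Not at hcon
          have : ∀ r, T ≤ r → r ≤ T + 1 + k → al r u = true := by
            intro r hr
            induction r, hr using Nat.le_induction with
            | base => exact fun _ => hA T T.lt_succ_self u hur
            | succ r hr ih => exact fun hr' => hcon r ⟨hr, by omega⟩ (ih (by omega))
          exact hau (this _ hs le_rfl)
        rw [H.alive_succ, not_and, not_not] at hr2
        have h1 : al r v = true := H.alive_anti hr.2.le h'
        have h2 := (hr2 hr1).2 i v (H.symm _ _ _ hm) h1
          ((H.stable hA hc hr.1 hv h1).2.trans hp)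
        exact H.finished_mono hA hc hr.1 (by omega) hv h2 fun q hq => H.alive_anti hq.le h

end

/-- All vertices are final after a number of iterations that is linear in the eccentricity. -/
theorem lt_of_alive {e : ℕ} (he : ∀ v, G.Reachable M v → G.dist M v ≤ e) {s : ℕ} {v : V}
    (hv : G.Reachable M v) (h : al s v = true) : s < 3 * e + 2 := by
  obtain ⟨T, hT, hA, hc⟩ := H.exists_complete he
  by_contra hs
  have hfin : ∀ u, G.Reachable M u → al (T + 1 + e) u = true →
      (ℓ (T + 1 + e) u).finished = true := by
    intro u hu hau
    have hd := he u hu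
    exact H.finished_mono hA hc (by omega) (by omega) hu
      (H.finished_of_dist_eq hA hc _ hu rfl (H.alive_anti (by omega) hau))
      fun r hr => H.alive_anti hr.le hau
  -- All remaining vertices are finished at time `T + 1 + e`; one more iteration lets each see that
  -- its children are, and become final.
  have h1 : al (T + 1 + e + 1) v = true := H.alive_anti (by omega) h
  obtain ⟨h2, h3⟩ := (H.alive_succ _ v).1 h1
  refine h3 ⟨(H.advances hA hc (by omega) hv h2).finished.2 (Or.inl (hfin v hv h2)), ?_⟩
  exact fun i u hm hu _ => hfin u (H.reachable_of_mem hm hv) hu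

end ComponentEvolution

end CuckooBFS

namespace CuckooBFS

/-! ### Clusters of items -/

/-- The items `x` and `y` have a common cell, if the values of the two hash functions are `f`. -/
def Touch {ι β : Type*} (f : ι × Bool → β) (x y : ι) : Prop := ∃ b, f (x, b) = f (y, b)

open Classical in
/-- The items in the same connected component as `x`. -/
noncomputable def cluster {ι β : Type*} [Fintype ι] (f : ι × Bool → β) (x : ι) : Finset ι :=
  Finset.univ.filter fun y => Relation.EqvGen (Touch f) x y

theorem mem_cluster {ι β : Type*} [Fintype ι] {f : ι × Bool → β} {x y : ι} :
    y ∈ cluster f x ↔ Relation.EqvGen (Touch f) x y := by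
  simp [cluster]

theorem cluster_card_pos {ι β : Type*} [Fintype ι] (f : ι × Bool → β) (x : ι) :
    0 < (cluster f x).card :=
  Finset.card_pos.2 ⟨x, mem_cluster.2 (.refl x)⟩

/-! ### The message complexity in terms of the sizes of the clusters -/

section

variable {𝒳 : Type*} [LinearOrder 𝒳] {m : ℕ} (X : Finset 𝒳) (h₁ h₂ : 𝒳 → Fin m)

/-- The values of both hash functions on `X`. -/
def hashes (p : X × Bool) : Fin m := if p.2 then h₂ p.1 else h₁ p.1

/-- The edges of the cuckoo graph. -/
def edgeList : List (𝒳 × Fin (m + m) × Fin (m + m)) :=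
  (X.sort (· ≤ ·)).map fun x => (x, Fin.castAdd m (h₁ x), Fin.natAdd m (h₂ x))

theorem input_eq : input X h₁ h₂ = (edgeList X h₁ h₂).map toValue := by
  simp [input, edgeList, toValue, Function.comp_def]

theorem mem_arcs_edgeList {i : 𝒳} {u v : Fin (m + m)} : (i, u, v) ∈ arcs (edgeList X h₁ h₂) ↔
    i ∈ X ∧ (u = Fin.castAdd m (h₁ i) ∧ v = Fin.natAdd m (h₂ i) ∨
      u = Fin.natAdd m (h₂ i) ∧ v = Fin.castAdd m (h₁ i)) := by
  simp only [arcs, edgeList, List.mem_flatMap, List.mem_map, Finset.mem_sort]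
  constructor
  · rintro ⟨e, ⟨x, hx, rfl⟩, h⟩
    simp only [List.mem_cons, List.not_mem_nil, or_false, Prod.mk.injEq] at h
    rcases h with ⟨rfl, h⟩ | ⟨rfl, h⟩
    · exact ⟨hx, Or.inl h⟩
    · exact ⟨hx, Or.inr h⟩
  · rintro ⟨hx, h⟩
    refine ⟨_, ⟨i, hx, rfl⟩, ?_⟩
    simpa using h

theorem castAdd_ne_natAdd (a b : Fin m) : Fin.castAdd m a ≠ Fin.natAdd m b := by
  intro h
  have := congrArg Fin.val h
  simp at this
  omega

/-- The cuckoo graph, without multiplicities. -/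
def cuckooGraph : SimpleGraph (Fin (m + m)) where
  Adj u v := ∃ i, (i, u, v) ∈ arcs (edgeList X h₁ h₂)
  symm := ⟨by
    rintro u v ⟨i, h⟩
    rw [mem_arcs_edgeList] at h
    exact ⟨i, (mem_arcs_edgeList X h₁ h₂).2 ⟨h.1, h.2.symm.imp And.symm And.symm⟩⟩⟩
  loopless := ⟨by
    rintro u ⟨i, h⟩
    rw [mem_arcs_edgeList] at h
    rcases h.2 with ⟨rfl, h⟩ | ⟨rfl, h⟩
    · exact castAdd_ne_natAdd _ _ h
    · exact castAdd_ne_natAdd _ _ h.symm⟩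

theorem eqvGen_of_reachable {u v : Fin (m + m)} (h : (cuckooGraph X h₁ h₂).Reachable u v)
    {x y : X} {u' v' : Fin (m + m)} (hx : ((x : 𝒳), u, u') ∈ arcs (edgeList X h₁ h₂))
    (hy : ((y : 𝒳), v, v') ∈ arcs (edgeList X h₁ h₂)) :
    Relation.EqvGen (Touch (hashes X h₁ h₂)) x y := by
  have touch : ∀ {x y : X} {w u' v' : Fin (m + m)}, ((x : 𝒳), w, u') ∈ arcs (edgeList X h₁ h₂) →
      ((y : 𝒳), w, v') ∈ arcs (edgeList X h₁ h₂) →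
      Relation.EqvGen (Touch (hashes X h₁ h₂)) x y := by
    intro x y w u' v' hx hy
    rw [mem_arcs_edgeList] at hx hy
    refine .rel _ _ ?_
    rcases hx.2 with ⟨hx, -⟩ | ⟨hx, -⟩ <;> rcases hy.2 with ⟨hy, -⟩ | ⟨hy, -⟩
    · exact ⟨false, by simpa [hashes, hx, Fin.ext_iff] using hy⟩
    · exact absurd (hx.symm.trans hy) (castAdd_ne_natAdd _ _)
    · exact absurd (hy.symm.trans hx) (castAdd_ne_natAdd _ _)
    · exact ⟨true, by simpa [hashes, hx, Fin.ext_iff] using hy⟩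
  obtain ⟨p⟩ := h
  induction p generalizing x u' with
  | nil => exact touch hx hy
  | @cons u w v huw p ih =>
    obtain ⟨i, hi⟩ := huw
    have hi' := (mem_arcs_edgeList X h₁ h₂).2 (((mem_arcs_edgeList X h₁ h₂).1 hi).imp id
      fun h => h.symm.imp And.symm And.symm)
    have hiX := ((mem_arcs_edgeList X h₁ h₂).1 hi).1
    exact (touch (y := ⟨i, hiX⟩) hx hi).trans _ _ _ (ih (x := ⟨i, hiX⟩) hi' hy)

/-- The edges of a shortest path are distinct, and each belongs to an item in the component of `x`.
-/
theorem dist_le_cluster_card {u v w : Fin (m + m)} {x : X}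
    (hx : ((x : 𝒳), u, v) ∈ arcs (edgeList X h₁ h₂)) {a : Fin (m + m)}
    (ha : (cuckooGraph X h₁ h₂).Reachable a u) (hw : (cuckooGraph X h₁ h₂).Reachable a w) :
    (cuckooGraph X h₁ h₂).dist a w ≤ (cluster (hashes X h₁ h₂) x).card := by
  obtain ⟨p, hp, hl⟩ := hw.exists_path_of_dist
  rw [← hl, ← p.length_edges, ← List.toFinset_card_of_nodup hp.isTrail.edges_nodup]
  refine (Finset.card_le_card ?_).trans (Finset.card_image_le
    (f := fun y : X => s(Fin.castAdd m (h₁ y), Fin.natAdd m (h₂ y))))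
  intro e he
  rw [List.mem_toFinset] at he
  induction e using Sym2.ind with
  | _ b c =>
    obtain ⟨i, hi⟩ := p.adj_of_mem_edges he
    have hb := p.fst_mem_support_of_mem_edges he
    have hiX := ((mem_arcs_edgeList X h₁ h₂).1 hi).1
    rw [Finset.mem_image]
    refine ⟨⟨i, hiX⟩, mem_cluster.2 (eqvGen_of_reachable X h₁ h₂
      (ha.symm.trans ⟨p.takeUntil b hb⟩) hx hi), ?_⟩
    rcases ((mem_arcs_edgeList X h₁ h₂).1 hi).2 with ⟨rfl, rfl⟩ | ⟨rfl, rfl⟩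
    · rfl
    · exact Sym2.eq_swap

/-- A vertex is processed for a number of iterations that is linear in the size of its component. -/
theorem lt_of_evolve {u v : Fin (m + m)} {x : X}
    (hx : ((x : 𝒳), u, v) ∈ arcs (edgeList X h₁ h₂)) {s : ℕ}
    (hs : (evolve (edgeList X h₁ h₂) s).1 u = true) :
    s < 3 * (cluster (hashes X h₁ h₂) x).card + 2 := by
  classical
  set G := cuckooGraph X h₁ h₂ with hG
  set S := Finset.univ.filter fun w => G.Reachable u w with hS
  have hne : S.Nonempty := ⟨u, by simp [hS]⟩
  have hM : G.Reachable u (S.min' hne) := (Finset.mem_filter.1 (S.min'_mem hne)).2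
  have H : ComponentEvolution (arcs (edgeList X h₁ h₂)) (fun s => (evolve (edgeList X h₁ h₂) s).1)
      (fun s => (evolve (edgeList X h₁ h₂) s).2) G (S.min' hne) :=
    { evolution (edgeList X h₁ h₂) with
      adj_iff := fun _ _ => Iff.rfl
      symm := fun i a b h => by
        rw [mem_arcs_edgeList] at h ⊢
        exact ⟨h.1, h.2.symm.imp And.symm And.symm⟩
      unique := fun i a a' b h h' => by
        rw [mem_arcs_edgeList] at h h'
        rcases h.2 with ⟨h1, h2⟩ | ⟨h1, h2⟩ <;> rcases h'.2 with ⟨h3, h4⟩ | ⟨h3, h4⟩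
        · exact h1.trans h3.symm
        · exact absurd (h4.symm.trans h2) (castAdd_ne_natAdd _ _)
        · exact absurd (h2.symm.trans h4) (castAdd_ne_natAdd _ _)
        · exact h1.trans h3.symm
      alive_of_reachable := fun w hw => by
        rw [(evolution (edgeList X h₁ h₂)).alive_zero, mem_verts]
        obtain ⟨p⟩ := hw.symm.trans hM.symm
        cases p with
        | nil => exact ⟨_, _, hx⟩
        | cons h p =>
          obtain ⟨i, hi⟩ := h
          exact ⟨i, _, hi⟩
      le_of_reachable := fun w hw => Finset.min'_le _ _ (by simp [hS, hM.trans hw]) }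
  exact H.lt_of_alive (fun w hw => dist_le_cluster_card X h₁ h₂ hx hM.symm hw) hM.symm hs

/-- Exchange of summations: an entry `a` is counted in at most `c a` rounds. -/
theorem sum_length_filter_le {α : Type*} (L : List α) (p : ℕ → α → Bool) (c : α → ℕ)
    (h : ∀ a ∈ L, ∀ s, p s a = true → s < c a) (t : ℕ) :
    ∑ s ∈ Finset.range t, (L.filter (p s)).length ≤ (L.map c).sum := by
  induction L with
  | nil => simp
  | cons a L ih =>
    have h1 : ∀ s, ((a :: L).filter (p s)).length =
        (if p s a = true then 1 else 0) + (L.filter (p s)).length := by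
      intro s
      rw [List.filter_cons]
      split <;> simp [add_comm]
    simp only [h1, Finset.sum_add_distrib, List.map_cons, List.sum_cons]
    refine Nat.add_le_add ?_ (ih fun b hb => h b (by simp [hb]))
    rw [Finset.sum_boole, Nat.cast_id]
    refine (Finset.card_le_card fun s hs => ?_).trans_eq (Finset.card_range (c a))
    rw [Finset.mem_range]
    exact h a (by simp) s (Finset.mem_filter.1 hs).2

/-- The message complexity is at most linear in the sum of the squares of the sizes of the
components. -/
theorem messageComplexity_le : messageComplexity X h₁ h₂ ≤
    ((230 * ∑ x : X, (cluster (hashes X h₁ h₂) x).card : ℕ) : ℕ∞) := by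
  set N : X → ℕ := fun x => (cluster (hashes X h₁ h₂) x).card with hN
  set E := edgeList X h₁ h₂ with hE
  rw [messageComplexity, MapReduce.messageComplexity, input_eq]
  refine iSup_le fun t => Nat.cast_le.2 ?_
  have hlen : E.length = X.card := by simp [hE, edgeList]
  have harcs : (arcs E).length = 2 * E.length := by
    simp [arcs, List.length_flatMap, mul_comm]
  have hcard : X.card ≤ ∑ x, N x := by
    have h1 : ∑ _x : X, 1 ≤ ∑ x, N x := Finset.sum_le_sum fun x _ => cluster_card_pos _ x
    simpa using h1
  have h0 : ∀ i, (algorithm (Fin (m + m)) 𝒳).phaseSize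
      ((algorithm (Fin (m + m)) 𝒳).run (E.map toValue) i) ≤
      10 * ((algorithm (Fin (m + m)) 𝒳).run (E.map toValue) i).length := fun i => phaseSize_le _
  classical
  set c : 𝒳 → ℕ := fun i => if hi : i ∈ X then 3 * N ⟨i, hi⟩ + 2 else 0 with hc
  have hsumc : ∑ x ∈ X, c x = ∑ x : X, (3 * N x + 2) := by
    rw [← Finset.sum_coe_sort]
    exact Finset.sum_congr rfl fun x _ => by simp [hc]
  have harcsum : ((arcs E).map fun a => c a.1).sum = 2 * ∑ x ∈ X, c x := by
    have h1 : ∀ L : List 𝒳, ((arcs (L.map fun x =>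
        (x, Fin.castAdd m (h₁ x), Fin.natAdd m (h₂ x)))).map fun a => c a.1).sum =
        2 * (L.map c).sum := by
      intro L
      induction L with
      | nil => rfl
      | cons x L ih =>
        simp only [arcs, List.map_cons, List.flatMap_cons, List.map_append, List.sum_append] at ih ⊢
        rw [ih]
        simp
        ring
    rw [hE, edgeList, h1, ← Multiset.sum_coe, ← Multiset.map_coe, Finset.sort_eq]
    rfl
  have hrun : ∑ s ∈ Finset.range t,
      ((algorithm (Fin (m + m)) 𝒳).run (E.map toValue) (s + 2)).length ≤
      2 * (2 * ∑ x : X, (3 * N x + 2)) := by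
    refine (Finset.sum_le_sum fun s _ => length_run_le E s).trans ?_
    rw [← Finset.mul_sum, ← hsumc, ← harcsum]
    refine Nat.mul_le_mul_left _ (sum_length_filter_le (arcs E)
      (fun s a => (evolve E s).1 a.2.1) (fun a => c a.1) (fun a ha s hs => ?_) t)
    have haX := ((mem_arcs_edgeList X h₁ h₂).1 ha).1
    simp only [hc, dif_pos haX]
    exact lt_of_evolve X h₁ h₂ (x := ⟨a.1, haX⟩) ha hs
  calc ∑ i ∈ Finset.range t, (algorithm (Fin (m + m)) 𝒳).phaseSize
        ((algorithm (Fin (m + m)) 𝒳).run (E.map toValue) i)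
      ≤ ∑ i ∈ Finset.range (t + 2), (algorithm (Fin (m + m)) 𝒳).phaseSize
        ((algorithm (Fin (m + m)) 𝒳).run (E.map toValue) i) :=
        Finset.sum_le_sum_of_subset (Finset.range_mono (by omega))
    _ ≤ ∑ i ∈ Finset.range (t + 2),
        10 * ((algorithm (Fin (m + m)) 𝒳).run (E.map toValue) i).length :=
        Finset.sum_le_sum fun i _ => h0 i
    -- The two set-up phases, split off here, start with `n` and `2 * n` values.
    _ = 10 * (∑ s ∈ Finset.range t,
        ((algorithm (Fin (m + m)) 𝒳).run (E.map toValue) (s + 2)).length +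
          2 * X.card + X.card) := by
        rw [← Finset.mul_sum, Finset.sum_range_succ', Finset.sum_range_succ',
          (run_one_perm E).length_eq]
        simp only [List.length_map, harcs, hlen]
        congr 2
        simp [MapReduce.run, hlen]
    _ ≤ 10 * (2 * (2 * ∑ x : X, (3 * N x + 2)) + 2 * X.card + X.card) := by gcongr
    -- The left side is `120 * ∑ N + 110 * n`, and `n ≤ ∑ N`.
    _ ≤ 230 * ∑ x, N x := by
        rw [Finset.sum_add_distrib, ← Finset.mul_sum]
        simp only [Finset.sum_const, Finset.card_univ, Fintype.card_coe, smul_eq_mul]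
        omega

end

end CuckooBFS

/-! ### Counting functions in boxes. -/

namespace Fintype

variable {κ β : Type*} [Fintype κ] [DecidableEq κ] [DecidableEq β]

/-- A box stands for a partially revealed function, and shrinking one side to a singleton reveals a
value. This is conditioning on the value at `p`. -/
theorem sum_piFinset_eq_sum_update (t : κ → Finset β) (p : κ) (W : (κ → β) → ℝ) :
    ∑ f ∈ piFinset t, W f = ∑ c ∈ t p, ∑ f ∈ piFinset (Function.update t p {c}), W f := by
  rw [← Finset.sum_fiberwise_of_maps_to (s := piFinset t) (t := t p) (g := fun f => f p)
    fun f hf => mem_piFinset.1 hf p]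
  refine Finset.sum_congr rfl fun c hc => Finset.sum_congr ?_ fun _ _ => rfl
  rw [piFinset_update_singleton_eq_filter_piFinset_eq _ _ hc]

/-- Conditioning on the answer to a single question: is `c` the value at `p`? -/
theorem sum_piFinset_eq_add (t : κ → Finset β) {p : κ} {c : β} (hc : c ∈ t p)
    (W : (κ → β) → ℝ) : ∑ f ∈ piFinset t, W f =
      ∑ f ∈ piFinset (Function.update t p {c}), W f +
        ∑ f ∈ piFinset (Function.update t p ((t p).erase c)), W f := by
  rw [sum_piFinset_eq_sum_update t p, sum_piFinset_eq_sum_update (Function.update t p ((t p).erase c)) p]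
  simp only [Function.update_self, Function.update_idem]
  exact (Finset.add_sum_erase (t p)
    (fun c => ∑ f ∈ piFinset (Function.update t p {c}), W f) hc).symm

theorem card_piFinset_update_mul (t : κ → Finset β) (p : κ) (T : Finset β) :
    (piFinset (Function.update t p T)).card * (t p).card = (piFinset t).card * T.card := by
  rw [card_piFinset, card_piFinset, ← Finset.mul_prod_erase _ _ (Finset.mem_univ p),
    ← Finset.mul_prod_erase _ (fun q => (t q).card) (Finset.mem_univ p)]
  have : ∏ q ∈ Finset.univ.erase p, (Function.update t p T q).card =
      ∏ q ∈ Finset.univ.erase p, (t q).card :=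
    Finset.prod_congr rfl fun q hq => by rw [Function.update_of_ne (Finset.ne_of_mem_erase hq)]
  rw [this, Function.update_self]
  ring

theorem card_piFinset_eq_sum_update (t : κ → Finset β) (p : κ) :
    ((piFinset t).card : ℝ) = ∑ c ∈ t p, ((piFinset (Function.update t p {c})).card : ℝ) := by
  simpa using sum_piFinset_eq_sum_update t p fun _ => 1

theorem mem_piFinset_of_update {t : κ → Finset β} {p : κ} {T : Finset β} (hT : T ⊆ t p)
    {f : κ → β} (hf : f ∈ piFinset (Function.update t p T)) : f ∈ piFinset t ∧ f p ∈ T := by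
  have h1 := mem_piFinset.1 hf p
  rw [Function.update_self] at h1
  refine ⟨mem_piFinset.2 fun q => ?_, h1⟩
  by_cases hq : q = p
  · subst hq; exact hT h1
  · simpa [Function.update_of_ne hq] using mem_piFinset.1 hf q

end Fintype

/-! ### The exponential moment, by lazy exploration of the components. -/

namespace CuckooBFS

section

variable {ι β : Type*} [Fintype ι] [DecidableEq ι] [Fintype β] [DecidableEq β]

/-- The labels `π` are constant on the components of the items in `Y`, and `0` on the components
that contain one of the cells in `Q`. -/
def IsLabelling (f : ι × Bool → β) (Y : Finset ι) (Q : Bool → Finset β) (π : ι → ℕ) : Prop :=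
  (∀ x ∈ Y, ∀ y ∈ Y, Touch f x y → π x = π y) ∧ ∀ x ∈ Y, ∀ b, f (x, b) ∈ Q b → π x = 0

/-- The sum of `ψ (size of the component of x)` over the items `x`, if components are described by
labels, and if the component with label `0` has `k` additional items. -/
def labelCost (ψ : ℕ → ℝ) (Y : Finset ι) (k : ℕ) (π : ι → ℕ) : ℝ :=
  ((k + (Y.filter fun y => π y = 0).card : ℕ) : ℝ) * ψ (k + (Y.filter fun y => π y = 0).card) +
    ∑ x ∈ Y.filter fun x => π x ≠ 0, ψ (Y.filter fun y => π y = π x).card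

theorem labelCost_congr (ψ : ℕ → ℝ) {Y : Finset ι} (k : ℕ) {π π' : ι → ℕ}
    (h : ∀ x ∈ Y, π x = π' x) : labelCost ψ Y k π = labelCost ψ Y k π' := by
  have h1 : (Y.filter fun y => π y = 0) = Y.filter fun y => π' y = 0 :=
    Finset.filter_congr fun x hx => by rw [h x hx]
  have h2 : (Y.filter fun y => π y ≠ 0) = Y.filter fun y => π' y ≠ 0 :=
    Finset.filter_congr fun x hx => by rw [h x hx]
  rw [labelCost, labelCost, h1, h2]
  congr 1
  refine Finset.sum_congr rfl fun x hx => ?_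
  have h3 : (Y.filter fun y => π y = π x) = Y.filter fun y => π' y = π' x :=
    Finset.filter_congr fun y hy => by rw [h y hy, h x (Finset.mem_filter.1 hx).1]
  rw [h3]

/-- An item with a cell in `Q` can be added to the component with label `0`. -/
theorem IsLabelling.insert_item {f : ι × Bool → β} {Y : Finset ι} {Q Q' : Bool → Finset β} {π : ι → ℕ}
    {x : ι} (hx : x ∉ Y) (h : IsLabelling f Y Q' π) (hQ : ∀ b, Q b ⊆ Q' b)
    (hfx : ∀ b, f (x, b) ∈ Q' b) (ψ : ℕ → ℝ) (k : ℕ) :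
    IsLabelling f (insert x Y) Q (Function.update π x 0) ∧
      labelCost ψ (insert x Y) k (Function.update π x 0) = labelCost ψ Y (k + 1) π := by
  have hne : ∀ y ∈ Y, y ≠ x := fun y hy => ne_of_mem_of_not_mem hy hx
  have h0 : ∀ y ∈ Y, Function.update π x 0 y = π y := fun y hy =>
    Function.update_of_ne (hne y hy) _ _
  refine ⟨⟨fun y hy z hz hyz => ?_, fun y hy b hb => ?_⟩, ?_⟩
  · rcases Finset.mem_insert.1 hy with hy | hy <;> rcases Finset.mem_insert.1 hz with hz | hz
    · rw [hy, hz]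
    · obtain ⟨b, hb⟩ := hyz
      rw [hy] at hb ⊢
      rw [Function.update_self, h0 z hz, h.2 z hz b (hb ▸ hfx b)]
    · obtain ⟨b, hb⟩ := hyz
      rw [hz] at hb ⊢
      rw [Function.update_self, h0 y hy, h.2 y hy b (hb ▸ hfx b)]
    · rw [h0 y hy, h0 z hz]
      exact h.1 y hy z hz hyz
  · rcases Finset.mem_insert.1 hy with hy | hy
    · rw [hy, Function.update_self]
    · rw [h0 y hy]
      exact h.2 y hy b (hQ b hb)
  · rw [← labelCost_congr ψ (k + 1) h0]
    simp only [labelCost]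
    have hx0 : Function.update π x 0 x = 0 := Function.update_self _ _ _
    rw [Finset.filter_insert, if_pos hx0, Finset.card_insert_of_notMem (by simp [hx]),
      Finset.filter_insert, if_neg (not_not.2 hx0), add_assoc, add_comm 1]
    congr 1
    refine Finset.sum_congr rfl fun y hy => ?_
    rw [Finset.filter_insert, if_neg]
    rw [hx0]
    exact (Finset.mem_filter.1 hy).2.symm

/-- If no cell is left in `Q`, the component with label `0` can be replaced by that of an item. -/
theorem IsLabelling.restart {f : ι × Bool → β} {Y : Finset ι} {Q Q' : Bool → Finset β} {π : ι → ℕ}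
    {x : ι} (hx : x ∉ Y) (h : IsLabelling f Y Q' π) (hQ : ∀ b, Q b = ∅)
    (hfx : ∀ b, f (x, b) ∈ Q' b) (ψ : ℕ → ℝ) (k : ℕ) :
    ∃ π', IsLabelling f (insert x Y) Q π' ∧
      labelCost ψ (insert x Y) k π' = k * ψ k + labelCost ψ Y 1 π := by
  obtain ⟨h1, h2⟩ := h.insert_item hx (fun b => by simp [hQ b] : ∀ b, Q b ⊆ Q' b) hfx ψ 0
  -- Shifting all labels by one leaves label `0` to the `k` items of the closed component; that of
  -- `x` gets label `1`.
  refine ⟨fun y => Function.update π x 0 y + 1, ⟨fun y hy z hz hyz => ?_, fun y hy b hb => ?_⟩, ?_⟩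
  · exact congrArg (· + 1) (h1.1 y hy z hz hyz)
  · simp [hQ b] at hb
  · rw [← zero_add 1, ← h2]
    simp only [labelCost, Nat.add_right_cancel_iff, Nat.add_eq_zero_iff, one_ne_zero, and_false,
      Finset.filter_false, Finset.card_empty, add_zero, ne_eq, not_false_iff, Finset.filter_true,
      zero_add]
    congr 1
    rw [← Finset.sum_filter_add_sum_filter_not _ fun y => Function.update π x 0 y = 0]
    congr 1
    rw [← nsmul_eq_mul, ← Finset.sum_const]
    refine Finset.sum_congr rfl fun y hy => ?_
    rw [(Finset.mem_filter.1 hy).2]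

/-- Parameters of the exponential moment bound: `s` and `ζ` are a fugacity for unexplored cells and
items. -/
structure Params (r s ζ δ : ℝ) (ψ : ℕ → ℝ) : Prop where
  r_nonneg : 0 ≤ r
  r_le : r ≤ 1
  one_le_s : 1 ≤ s
  one_le_zeta : 1 ≤ ζ
  delta_nonneg : 0 ≤ δ
  exp_le : Real.exp (r * (ζ * s - 1)) ≤ s
  cost_le : ∀ k : ℕ, Real.exp (k * ψ k) ≤ 1 + δ * ζ ^ k

/-- The cells in `Q` are unexplored, and they are few. -/
structure Fits (r : ℝ) (n : ℕ) (A Q : Bool → Finset β) : Prop where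
  subset : ∀ b, Q b ⊆ A b
  card_le : ∀ b, (n : ℝ) ≤ r * ((A b).card - (Q b).card)

/-- `W` is bounded in terms of every labelling of `Y`. -/
def Bounded (ψ : ℕ → ℝ) (t : ι × Bool → Finset β) (Y : Finset ι) (Q : Bool → Finset β) (k : ℕ)
    (W : (ι × Bool → β) → ℝ) : Prop :=
  ∀ f ∈ Fintype.piFinset t, ∀ π, IsLabelling f Y Q π → W f ≤ Real.exp (labelCost ψ Y k π)

/-- The exponential moment bound for partially revealed hash functions. -/
def MomentBound (s ζ δ : ℝ) (ψ : ℕ → ℝ) (Y : Finset ι) (A Q : Bool → Finset β) : Prop :=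
  ∀ (t : ι × Bool → Finset β) (k : ℕ) (W : (ι × Bool → β) → ℝ),
    (∀ x ∈ Y, ∀ b, t (x, b) = A b) → Bounded ψ t Y Q k W →
    ∑ f ∈ Fintype.piFinset t, W f ≤ ((Fintype.piFinset t).card : ℝ) *
      ((1 + δ * ζ * s ^ 2) ^ Y.card * (1 + δ * ζ ^ k * s ^ ∑ b, (Q b).card))

variable {r s ζ δ : ℝ} {ψ : ℕ → ℝ}

/-- Only the current component, with exactly `k` items, remains to be paid for; the factor for
unexplored cells is at least one. -/
theorem momentBound_empty (hP : Params r s ζ δ ψ) (A Q : Bool → Finset β) :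
    MomentBound s ζ δ ψ (∅ : Finset ι) A Q := by
  intro t k W _ hW
  have h1 : ∀ f ∈ Fintype.piFinset t, W f ≤ 1 + δ * ζ ^ k * s ^ ∑ b, (Q b).card := by
    intro f hf
    refine (hW f hf (fun _ => 0) ⟨by simp, by simp⟩).trans ?_
    have h2 : labelCost ψ (∅ : Finset ι) k (fun _ => 0) = k * ψ k := by simp [labelCost]
    rw [h2]
    refine (hP.cost_le k).trans (add_le_add_right ?_ 1)
    have h3 : 0 ≤ δ * ζ ^ k := mul_nonneg hP.delta_nonneg (pow_nonneg (zero_le_one.trans hP.one_le_zeta) k)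
    exact le_mul_of_one_le_right h3 (one_le_pow₀ hP.one_le_s)
  refine (Finset.sum_le_card_nsmul _ _ _ h1).trans_eq ?_
  rw [nsmul_eq_mul]
  simp

theorem sum_card_update (Q : Bool → Finset β) (b : Bool) (T : Finset β) :
    ∑ b', (Function.update Q b T b').card + (Q b).card = ∑ b', (Q b').card + T.card := by
  cases b <;> simp [Function.update] <;> omega

/-- An explored cell leaves both the range and the queue, so the difference of their sizes is
unchanged. -/
theorem Fits.erase {n : ℕ} {A Q : Bool → Finset β} (h : Fits r n A Q) {b : Bool} {v : β}
    (hv : v ∈ Q b) : Fits r n (Function.update A b ((A b).erase v))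
      (Function.update Q b ((Q b).erase v)) := by
  have hvA := h.subset b hv
  constructor
  · intro b'
    by_cases hb : b' = b
    · subst hb
      simpa using Finset.erase_subset_erase v (h.subset b')
    · simpa [Function.update_of_ne hb] using h.subset b'
  · intro b'
    by_cases hb : b' = b
    · subst hb
      rw [Function.update_self, Function.update_self, Finset.cast_card_erase_of_mem hvA,
        Finset.cast_card_erase_of_mem hv]
      simpa using h.card_le b'
    · simpa [Function.update_of_ne hb] using h.card_le b'

/-- The item that is used up pays for the cell it adds, because `r ≤ 1`. -/
theorem Fits.insert_cell {n : ℕ} {A Q : Bool → Finset β} (hr₀ : 0 ≤ r) (hr : r ≤ 1)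
    (h : Fits r (n + 1) A Q) {b : Bool} {c : β} (hc : c ∈ A b) :
    Fits r n A (Function.update Q b (insert c (Q b))) := by
  constructor
  · intro b'
    by_cases hb : b' = b
    · subst hb
      simpa using Finset.insert_subset hc (h.subset b')
    · simpa [Function.update_of_ne hb] using h.subset b'
  · intro b'
    have h1 := h.card_le b'
    push_cast at h1
    by_cases hb : b' = b
    · subst hb
      have h2 : ((insert c (Q b')).card : ℝ) ≤ (Q b').card + 1 := by
        exact_mod_cast Finset.card_insert_le c (Q b')
      rw [Function.update_self]
      nlinarith
    · rw [Function.update_of_ne hb]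
      linarith

/-- The items in `Y` are asked, one after the other, if `v` is one of their cells; the items in `Z`
have answered that it is not. -/
theorem sum_le_of_probe (hP : Params r s ζ δ ψ) {N : ℕ} {b : Bool} {v : β} {A : Bool → Finset β}
    (hN : ∀ (Z : Finset ι) (A Q : Bool → Finset β), Fits r Z.card A Q →
      3 * Z.card + ∑ b, (Q b).card < N → MomentBound s ζ δ ψ Z A Q)
    (Y Z : Finset ι) (hYZ : Disjoint Y Z) (Q : Bool → Finset β) (hv : v ∈ Q b)
    (hQ : Fits r (Y.card + Z.card) A Q) (hle : 3 * (Y.card + Z.card) + ∑ b, (Q b).card ≤ N)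
    (t : ι × Bool → Finset β) (k : ℕ) (W : (ι × Bool → β) → ℝ)
    (htY : ∀ x ∈ Y, ∀ b, t (x, b) = A b)
    (htZ : ∀ x ∈ Z, ∀ b', t (x, b') = Function.update A b ((A b).erase v) b')
    (hW : Bounded ψ t (Y ∪ Z) Q k W) :
    ∑ f ∈ Fintype.piFinset t, W f ≤ ((Fintype.piFinset t).card : ℝ) *
      ((1 + δ * ζ * s ^ 2) ^ (Y.card + Z.card) * (1 + δ * ζ ^ k * s ^ ((∑ b, (Q b).card) - 1) *
        (1 + (ζ * s - 1) / (A b).card) ^ Y.card)) := by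
  have hs0 : 0 ≤ s := zero_le_one.trans hP.one_le_s
  have hz0 : 0 ≤ ζ := zero_le_one.trans hP.one_le_zeta
  have hδ := hP.delta_nonneg
  have hB : 1 ≤ 1 + δ * ζ * s ^ 2 := le_add_of_nonneg_right (by positivity)
  have hζs : 1 ≤ ζ * s := one_le_mul_of_one_le_of_one_le hP.one_le_zeta hP.one_le_s
  set ρ := 1 + (ζ * s - 1) / (A b).card with hρ
  have hρ0 : 0 ≤ ρ := add_nonneg zero_le_one (div_nonneg (by linarith) (Nat.cast_nonneg _))
  induction Y using Finset.induction_on generalizing Z Q t k with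
  | empty =>
    have hsum := sum_card_update Q b ((Q b).erase v)
    rw [Finset.card_erase_of_mem hv] at hsum
    have hpos := Finset.card_pos.2 ⟨v, hv⟩
    simp only [Finset.card_empty, zero_add, Finset.empty_union, pow_zero, mul_one] at *
    -- Nobody is left to ask: no item of `Z` lies in `v`, so a labelling for the queue without `v`
    -- is one for `Q`.
    have h1 := hN Z _ _ (hQ.erase hv) (by omega) t k W htZ fun f hf π hπ =>
      hW f hf π ⟨hπ.1, fun x hx b' hb' => hπ.2 x hx b' ?_⟩
    · rwa [show ∑ b', (Function.update Q b ((Q b).erase v) b').card = ∑ b, (Q b).card - 1 by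
        omega] at h1
    · by_cases hb : b' = b
      · subst hb
        have h2 := Fintype.mem_piFinset.1 hf (x, b')
        rw [htZ x hx, Function.update_self] at h2
        rw [Function.update_self]
        exact Finset.mem_erase.2 ⟨(Finset.mem_erase.1 h2).1, hb'⟩
      · rwa [Function.update_of_ne hb]
  | insert x Y hx ih =>
    have hxZ : x ∉ Z := Finset.disjoint_left.1 hYZ (Finset.mem_insert_self x Y)
    have hYZ' : Disjoint Y Z := hYZ.mono_left (Finset.subset_insert x Y)
    have hvA : v ∈ A b := hQ.subset b hv
    have htp : t (x, b) = A b := htY x (Finset.mem_insert_self x Y) b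
    have htp' : t (x, !b) = A (!b) := htY x (Finset.mem_insert_self x Y) (!b)
    have hnb : (x, !b) ≠ (x, b) := by simp
    have hcard : (insert x Y).card = Y.card + 1 := Finset.card_insert_of_notMem hx
    have hq0 : 0 < ∑ b, (Q b).card :=
      (Finset.card_pos.2 ⟨v, hv⟩).trans_le (Finset.single_le_sum (f := fun b => (Q b).card)
        (fun _ _ => Nat.zero_le _) (Finset.mem_univ b))
    obtain ⟨q, hq⟩ : ∃ q, ∑ b, (Q b).card = q + 1 := ⟨_, (Nat.succ_pred_eq_of_pos hq0).symm⟩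
    rw [hcard] at hQ hle ⊢
    rw [hq] at hle ⊢
    rw [Nat.add_sub_cancel]
    set B := 1 + δ * ζ * s ^ 2 with hBdef
    set t₁ := Function.update t (x, b) {v} with ht₁
    set t₂ := Function.update t (x, b) ((A b).erase v) with ht₂
    have hvt : v ∈ t (x, b) := htp ▸ hvA
    -- `v` is not a cell of `x`
    have hmiss : ∑ f ∈ Fintype.piFinset t₂, W f ≤ ((Fintype.piFinset t₂).card : ℝ) *
        (B ^ (Y.card + 1 + Z.card) * (1 + δ * ζ ^ k * s ^ q * ρ ^ Y.card)) := by
      have hcZ : Y.card + (insert x Z).card = Y.card + 1 + Z.card := by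
        rw [Finset.card_insert_of_notMem hxZ]; omega
      have h1 := ih (insert x Z) (Finset.disjoint_insert_right.2 ⟨hx, hYZ'⟩) Q hv
        (by rwa [hcZ]) (by rw [hcZ, hq]; exact hle) t₂ k
        (fun y hy b' => ?_) (fun z hz b' => ?_) (fun f hf π hπ => ?_)
      · rwa [hcZ, hq, Nat.add_sub_cancel] at h1
      · rw [ht₂, Function.update_of_ne (by rintro ⟨⟩; exact hx hy)]
        exact htY y (Finset.mem_insert_of_mem hy) b'
      · by_cases hzx : z = x
        · subst hzx
          by_cases hb : b' = b
          · subst hb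
            rw [ht₂, Function.update_self, Function.update_self]
          · rw [ht₂, Function.update_of_ne (by simpa using hb), Function.update_of_ne hb]
            exact htY z (Finset.mem_insert_self z Y) b'
        · rw [ht₂, Function.update_of_ne (by simp [hzx])]
          exact htZ z (Finset.mem_of_mem_insert_of_ne hz hzx) b'
      · rw [Finset.union_insert, ← Finset.insert_union] at hπ ⊢
        exact hW f (Fintype.mem_piFinset_of_update (htp ▸ Finset.erase_subset v _) hf).1 π hπ
    -- `v` is a cell of `x`
    have hhit : ∑ f ∈ Fintype.piFinset t₁, W f ≤ ((Fintype.piFinset t₁).card : ℝ) *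
        (B ^ (Y.card + 1 + Z.card) * (1 + δ * ζ ^ (k + 1) * s ^ (q + 1) * ρ ^ Y.card)) := by
      -- The other cell `c` of `x` is revealed too and enters the queue, where it may already be.
      -- Item and cell together cost at most `ζ * s`.
      rw [Fintype.sum_piFinset_eq_sum_update t₁ (x, !b),
        Fintype.card_piFinset_eq_sum_update t₁ (x, !b), Finset.sum_mul]
      refine Finset.sum_le_sum fun c hc => ?_
      have ht₁' : t₁ (x, !b) = A (!b) := by rw [ht₁, Function.update_of_ne hnb, htp']
      rw [ht₁'] at hc
      set Q' := Function.update Q (!b) (insert c (Q (!b))) with hQ'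
      have hQQ' : ∀ b', Q b' ⊆ Q' b' := by
        intro b'
        by_cases hb : b' = !b
        · subst hb
          simp [hQ', Finset.subset_insert]
        · simp [hQ', Function.update_of_ne hb]
      have hQs : ∑ b, (Q' b).card ≤ q + 1 + 1 := by
        have h1 := sum_card_update Q (!b) (insert c (Q (!b)))
        have h2 := Finset.card_insert_le c (Q (!b))
        rw [← hQ'] at h1
        omega
      have hQ'b : Q' b = Q b := Function.update_of_ne (by simp) _ _
      have h1 := ih Z hYZ' Q' (by rwa [hQ'b])
        (Fits.insert_cell hP.r_nonneg hP.r_le (by rwa [add_right_comm] at hQ) hc) (by omega)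
        (Function.update t₁ (x, !b) {c}) (k + 1) (fun y hy b' => ?_) (fun z hz b' => ?_)
        (fun f hf π hπ => ?_)
      · refine h1.trans (mul_le_mul_of_nonneg_left ?_ (Nat.cast_nonneg _))
        refine mul_le_mul (pow_le_pow_right₀ hB (by omega)) ?_ (by positivity) (by positivity)
        have h2 : s ^ (∑ b, (Q' b).card - 1) ≤ s ^ (q + 1) :=
          pow_le_pow_right₀ hP.one_le_s (by omega)
        gcongr
      · have hyx : y ≠ x := fun h => hx (h ▸ hy)
        rw [Function.update_of_ne (by simp [hyx]), ht₁, Function.update_of_ne (by simp [hyx])]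
        exact htY y (Finset.mem_insert_of_mem hy) b'
      · have hzx : z ≠ x := fun h => hxZ (h ▸ hz)
        rw [Function.update_of_ne (by simp [hzx]), ht₁, Function.update_of_ne (by simp [hzx])]
        exact htZ z hz b'
      · obtain ⟨hf₁, hfc⟩ := Fintype.mem_piFinset_of_update
          (by rw [ht₁']; exact Finset.singleton_subset_iff.2 hc) hf
        obtain ⟨hf₂, hfv⟩ := Fintype.mem_piFinset_of_update
          (Finset.singleton_subset_iff.2 hvt) hf₁
        have hfx : ∀ b', f (x, b') ∈ Q' b' := by
          intro b'
          by_cases hb : b' = b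
          · rw [hb, hQ'b, Finset.mem_singleton.1 hfv]
            exact hv
          · obtain rfl : b' = !b := by cases b <;> cases b' <;> simp_all
            rw [hQ', Function.update_self, Finset.mem_singleton.1 hfc]
            exact Finset.mem_insert_self _ _
        obtain ⟨h2, h3⟩ := hπ.insert_item (x := x) (Q := Q) (by simp [hx, hxZ]) hQQ' hfx ψ k
        rw [← h3]
        rw [Finset.insert_union] at hW
        exact hW f hf₂ _ h2
    have hsplit := Fintype.sum_piFinset_eq_add t hvt W
    rw [htp, ← ht₁, ← ht₂] at hsplit
    have ha : (0 : ℝ) < (A b).card := Nat.cast_pos.2 (Finset.card_pos.2 ⟨v, hvA⟩)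
    have hc₁ : ((Fintype.piFinset t₁).card : ℝ) * (A b).card = (Fintype.piFinset t).card := by
      have := Fintype.card_piFinset_update_mul t (x, b) {v}
      rw [htp, Finset.card_singleton, mul_one] at this
      exact_mod_cast this
    have hc₂ : ((Fintype.piFinset t₂).card : ℝ) * (A b).card =
        (Fintype.piFinset t).card * ((A b).card - 1) := by
      have := Fintype.card_piFinset_update_mul t (x, b) ((A b).erase v)
      rw [htp] at this
      rw [← Finset.cast_card_erase_of_mem hvA]
      exact_mod_cast this
    rw [hsplit]
    refine (add_le_add hhit hmiss).trans_eq ?_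
    -- Averaging hit and miss with weights `1 / a` and `1 - 1 / a`, where `a` is the size of `A b`,
    -- produces exactly one more factor `ρ`.
    rw [← eq_div_iff ha.ne'] at hc₁ hc₂
    rw [hc₁, hc₂, pow_succ ρ, hρ]
    field_simp
    ring

end

end CuckooBFS

namespace CuckooBFS

variable {ι β : Type*} [Fintype ι] [DecidableEq ι] [Fintype β] [DecidableEq β]
  {r s ζ δ : ℝ} {ψ : ℕ → ℝ}

/-- Asking all remaining items about one cell costs at most the factor `s` that this cell carries.
-/
theorem probe_pow_le (hP : Params r s ζ δ ψ) {n a : ℕ} (h : (n : ℝ) ≤ r * a) :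
    (1 + (ζ * s - 1) / a) ^ n ≤ s := by
  have hζs : 1 ≤ ζ * s := one_le_mul_of_one_le_of_one_le hP.one_le_zeta hP.one_le_s
  -- For `a = 0` division by zero makes the base `1`.
  rcases Nat.eq_zero_or_pos a with rfl | ha
  · simpa using hP.one_le_s
  have ha' : (0 : ℝ) < a := Nat.cast_pos.2 ha
  refine le_trans ?_ hP.exp_le
  calc (1 + (ζ * s - 1) / a) ^ n ≤ Real.exp ((ζ * s - 1) / a) ^ n := by
        refine pow_le_pow_left₀ (add_nonneg zero_le_one (div_nonneg (by linarith) ha'.le)) ?_ n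
        rw [add_comm]
        exact Real.add_one_le_exp _
    _ = Real.exp (n * ((ζ * s - 1) / a)) := (Real.exp_nat_mul _ _).symm
    _ ≤ Real.exp (r * (ζ * s - 1)) := by
        refine Real.exp_le_exp.2 ?_
        rw [mul_div_assoc', div_le_iff₀ ha']
        nlinarith

/-- While the queue is nonempty, one of its cells is explored and its factor `s` absorbs the probes.
Once it is empty, the component is closed for `1 + δ * ζ ^ k`, and a new item with its two cells
opens the next one; this gives one factor `1 + δ * ζ * s ^ 2` per item at most. -/
theorem momentBound (hP : Params r s ζ δ ψ) (Y : Finset ι) (A Q : Bool → Finset β)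
    (hQ : Fits r Y.card A Q) : MomentBound s ζ δ ψ Y A Q := by
  -- An item weighs three cells: opening a component uses one item and adds two cells, so the
  -- measure still drops.
  induction hN : 3 * Y.card + ∑ b, (Q b).card using Nat.strong_induction_on
    generalizing Y A Q with
  | _ N ih =>
    have hN' : ∀ (Z : Finset ι) (A Q : Bool → Finset β), Fits r Z.card A Q →
        3 * Z.card + ∑ b, (Q b).card < N → MomentBound s ζ δ ψ Z A Q :=
      fun Z A Q hZ hlt => ih _ hlt Z A Q hZ rfl
    have hs0 : 0 ≤ s := zero_le_one.trans hP.one_le_s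
    have hz0 : 0 ≤ ζ := zero_le_one.trans hP.one_le_zeta
    have hδ := hP.delta_nonneg
    have hB : 1 ≤ 1 + δ * ζ * s ^ 2 := le_add_of_nonneg_right (by positivity)
    rcases Y.eq_empty_or_nonempty with rfl | ⟨x, hx⟩
    · exact momentBound_empty hP A Q
    intro t k W ht hW
    by_cases hq : ∃ b v, v ∈ Q b
    · obtain ⟨b, v, hv⟩ := hq
      have h1 := sum_le_of_probe hP hN' Y ∅ (Finset.disjoint_empty_right Y) Q hv (by simpa using hQ)
        (by simpa using hN.le) t k W ht (by simp) (by simpa using hW)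
      refine h1.trans (mul_le_mul_of_nonneg_left ?_ (Nat.cast_nonneg _))
      rw [Finset.card_empty, add_zero]
      refine mul_le_mul_of_nonneg_left ?_ (by positivity)
      have hq0 : 0 < ∑ b, (Q b).card :=
        (Finset.card_pos.2 ⟨v, hv⟩).trans_le (Finset.single_le_sum (f := fun b => (Q b).card)
          (fun _ _ => Nat.zero_le _) (Finset.mem_univ b))
      obtain ⟨q, hq⟩ : ∃ q, ∑ b, (Q b).card = q + 1 := ⟨_, (Nat.succ_pred_eq_of_pos hq0).symm⟩
      rw [hq, Nat.add_sub_cancel, pow_succ, ← mul_assoc]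
      have h2 : (Y.card : ℝ) ≤ r * (A b).card := by
        refine (hQ.card_le b).trans (mul_le_mul_of_nonneg_left ?_ hP.r_nonneg)
        linarith [(Nat.cast_nonneg _ : (0 : ℝ) ≤ (Q b).card)]
      have h3 := probe_pow_le hP h2
      gcongr
    · push Not at hq
      have hQe : ∀ b, Q b = ∅ := fun b => Finset.eq_empty_of_forall_notMem (hq b)
      have hxY : x ∉ Y.erase x := Finset.notMem_erase x Y
      have hYx : insert x (Y.erase x) = Y := Finset.insert_erase hx
      have hcard : Y.card = (Y.erase x).card + 1 := by
        rw [Finset.card_erase_add_one hx]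
      have hne : (x, true) ≠ (x, false) := by simp
      simp only [hQe, Finset.card_empty, Finset.sum_const_zero, pow_zero, mul_one] at hN ⊢
      rw [Fintype.sum_piFinset_eq_sum_update t (x, false),
        Fintype.card_piFinset_eq_sum_update t (x, false), Finset.sum_mul]
      refine Finset.sum_le_sum fun c₀ hc₀ => ?_
      set t₁ := Function.update t (x, false) {c₀} with ht₁
      rw [Fintype.sum_piFinset_eq_sum_update t₁ (x, true),
        Fintype.card_piFinset_eq_sum_update t₁ (x, true), Finset.sum_mul]
      refine Finset.sum_le_sum fun c₁ hc₁ => ?_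
      set t₂ := Function.update t₁ (x, true) {c₁} with ht₂
      set Q' : Bool → Finset β := fun b => if b then {c₁} else {c₀} with hQ'
      have hQs : ∑ b, (Q' b).card = 2 := by simp [hQ']
      have htc₁ : t₁ (x, true) = A true := by rw [ht₁, Function.update_of_ne hne, ht x hx]
      have hfit : Fits r (Y.erase x).card A Q' := by
        rw [ht x hx] at hc₀
        rw [htc₁] at hc₁
        constructor
        · rintro (_ | _)
          · simpa [hQ'] using hc₀
          · simpa [hQ'] using hc₁
        · intro b
          have h1 := hQ.card_le b
          have h2 : (Q' b).card = 1 := by cases b <;> simp [hQ']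
          rw [hcard, hQe b] at h1
          push_cast at h1
          rw [Finset.card_empty, Nat.cast_zero, sub_zero] at h1
          rw [h2, Nat.cast_one, mul_sub, mul_one]
          linarith [hP.r_le]
      -- Dividing `W` by the cost of the closed component lets the count start again at `1`.
      have h1 := hN' (Y.erase x) A Q' hfit (by omega) t₂ 1
        (fun f => W f * (Real.exp (k * ψ k))⁻¹) (fun y hy b => ?_) (fun f hf π hπ => ?_)
      · rw [← Finset.sum_mul, ← div_eq_mul_inv, div_le_iff₀ (Real.exp_pos _), hQs, pow_one] at h1
        refine h1.trans ?_
        rw [mul_assoc]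
        refine mul_le_mul_of_nonneg_left ?_ (Nat.cast_nonneg _)
        rw [hcard, pow_succ]
        exact mul_le_mul_of_nonneg_left (hP.cost_le k) (by positivity)
      · have hyx : y ≠ x := Finset.ne_of_mem_erase hy
        rw [ht₂, Function.update_of_ne (by simp [hyx]), ht₁, Function.update_of_ne (by simp [hyx])]
        exact ht y (Finset.mem_of_mem_erase hy) b
      · obtain ⟨hf₁, hfc₁⟩ := Fintype.mem_piFinset_of_update
          (Finset.singleton_subset_iff.2 hc₁) hf
        obtain ⟨hf₂, hfc₀⟩ := Fintype.mem_piFinset_of_update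
          (Finset.singleton_subset_iff.2 hc₀) hf₁
        have hfx : ∀ b, f (x, b) ∈ Q' b := by
          rintro (_ | _)
          · simpa [hQ'] using hfc₀
          · simpa [hQ'] using hfc₁
        obtain ⟨π', h2, h3⟩ := hπ.restart hxY hQe hfx ψ k
        rw [hYx] at h2 h3
        have h4 := hW f hf₂ π' h2
        rw [h3, add_comm, Real.exp_add] at h4
        change W f * _ ≤ _
        rw [← div_eq_mul_inv]
        exact (div_le_iff₀ (Real.exp_pos _)).2 h4

/-- Label classes are unions of components, so replacing components by them only increases a
monotone `ψ`. -/
theorem sum_cluster_le_labelCost {f : ι × Bool → β} {π : ι → ℕ}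
    (h : IsLabelling f Finset.univ (fun _ => ∅) π) (hψ : Monotone ψ) :
    ∑ x, ψ (cluster f x).card ≤ labelCost ψ Finset.univ 0 π := by
  have h1 : ∀ x y, Relation.EqvGen (Touch f) x y → π x = π y := by
    intro x y hxy
    induction hxy with
    | rel x y hxy => exact h.1 x (Finset.mem_univ x) y (Finset.mem_univ y) hxy
    | refl x => rfl
    | symm x y _ ih => exact ih.symm
    | trans x y z _ _ ih ih' => exact ih.trans ih'
  have h2 : ∀ x, ψ (cluster f x).card ≤ ψ (Finset.univ.filter fun y => π y = π x).card := by
    refine fun x => hψ (Finset.card_le_card fun y hy => ?_)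
    simpa using (h1 x y (mem_cluster.1 hy)).symm
  rw [← Finset.sum_filter_add_sum_filter_not _ fun x => π x = 0, labelCost, zero_add]
  refine add_le_add ?_ (Finset.sum_le_sum fun x _ => h2 x)
  rw [← nsmul_eq_mul, ← Finset.sum_const]
  refine Finset.sum_le_sum fun x hx => (h2 x).trans_eq ?_
  rw [(Finset.mem_filter.1 hx).2]

/-- The exponential moment bound for the sum over the items of a function of the sizes of their
components. -/
theorem sum_exp_cluster_le (hP : Params r s ζ δ ψ) (hψ : Monotone ψ)
    (hn : (Fintype.card ι : ℝ) ≤ r * Fintype.card β) :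
    ∑ f : ι × Bool → β, Real.exp (∑ x, ψ (cluster f x).card) ≤
      (Fintype.card (ι × Bool → β) : ℝ) *
        ((1 + δ * ζ * s ^ 2) ^ Fintype.card ι * (1 + δ)) := by
  have h := momentBound hP (Finset.univ : Finset ι) (fun _ => (Finset.univ : Finset β))
    (fun _ => ∅) ⟨by simp, by simpa using hn⟩ (fun _ => Finset.univ) 0
    (fun f => Real.exp (∑ x, ψ (cluster f x).card)) (by simp)
    (fun f _ π hπ => Real.exp_le_exp.2 (sum_cluster_le_labelCost hπ hψ))
  simpa using h

end CuckooBFS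

namespace CuckooBFS

/-! ### The sum of the sizes of the clusters -/

theorem cluster_card_eq {ι β : Type*} [Fintype ι] {f : ι × Bool → β} {x y : ι}
    (h : y ∈ cluster f x) : (cluster f y).card = (cluster f x).card := by
  rw [mem_cluster] at h
  congr 1
  ext z
  rw [mem_cluster, mem_cluster]
  exact ⟨fun hz => h.trans _ _ _ hz, fun hz => (h.symm _ _).trans _ _ _ hz⟩

/-- `min (k / L) 1`, scaled by `θ`. -/
noncomputable def weight (θ L : ℝ) (k : ℕ) : ℝ := θ * min (k / L) 1

theorem weight_nonneg {θ L : ℝ} (hθ : 0 ≤ θ) (hL : 0 ≤ L) (k : ℕ) : 0 ≤ weight θ L k :=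
  mul_nonneg hθ (le_min (by positivity) zero_le_one)

theorem weight_mono {θ L : ℝ} (hθ : 0 ≤ θ) (hL : 0 ≤ L) : Monotone (weight θ L) := by
  intro k k' h
  unfold weight
  have : (k : ℝ) ≤ k' := Nat.cast_le.2 h
  gcongr

/-- Both sides of the minimum are used: `k / L` supplies the small factor `1 / L`, and the
truncation at `1` keeps the exponential growth in `k` at a rate independent of `L`. -/
theorem exp_mul_weight_le {θ L : ℝ} (hθ : 0 < θ) (hL : 0 < L) (k : ℕ) :
    Real.exp (k * weight θ L k) ≤ 1 + 2 / θ / L * Real.exp (2 * θ) ^ k := by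
  set y := k * weight θ L k with hy
  have hk : (0 : ℝ) ≤ k := Nat.cast_nonneg k
  have hy0 : 0 ≤ y := mul_nonneg hk (weight_nonneg hθ.le hL.le k)
  have h1 : y ≤ θ * k ^ 2 / L := by
    have : y ≤ k * (θ * (k / L)) := by
      rw [hy, weight]
      gcongr
      exact min_le_left _ _
    refine this.trans_eq ?_
    ring
  have h2 : y ≤ θ * k := by
    have : y ≤ k * (θ * 1) := by
      rw [hy, weight]
      gcongr
      exact min_le_right _ _
    linarith
  have h3 : Real.exp y ≤ 1 + y * Real.exp y := by
    have h4 := Real.one_sub_le_exp_neg y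
    have h5 : Real.exp (-y) * Real.exp y = 1 := by rw [← Real.exp_add]; simp
    nlinarith [Real.exp_pos y]
  have h4 : θ * k ^ 2 ≤ 2 / θ * Real.exp (θ * k) := by
    have h5 := Real.quadratic_le_exp_of_nonneg (mul_nonneg hθ.le hk)
    rw [div_mul_eq_mul_div, le_div_iff₀ hθ]
    nlinarith [mul_nonneg hθ.le hk]
  have h5 : Real.exp (2 * θ) ^ k = Real.exp (θ * k) * Real.exp (θ * k) := by
    rw [← Real.exp_nat_mul, ← Real.exp_add]
    congr 1
    ring
  refine h3.trans (add_le_add_right ?_ 1)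
  calc y * Real.exp y ≤ θ * k ^ 2 / L * Real.exp (θ * k) := by gcongr
    _ ≤ 2 / θ * Real.exp (θ * k) / L * Real.exp (θ * k) := by gcongr
    _ = 2 / θ / L * Real.exp (2 * θ) ^ k := by rw [h5]; ring

/-- With `ζ = 1` the condition on `s` would hold with slack, since `log s ≥ 1 - s⁻¹` and `(1 - ε) *
(1 + ε / 2) < 1`. The slack is of order `ε ^ 2`, which leaves room for `ζ = 1 + ε ^ 2 / 8`; `θ` is
half its logarithm. -/
theorem exists_params {ε : ℝ} (hε₀ : 0 < ε) (hε₁ : ε < 1) : ∃ s θ : ℝ, 0 < s ∧ 0 < θ ∧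
    ∀ L : ℝ, 0 < L → Params (1 - ε) s (Real.exp (2 * θ)) (2 / θ / L) (weight θ L) := by
  have hζ : 1 < 1 + ε ^ 2 / 8 := by
    have : 0 < ε ^ 2 / 8 := by positivity
    linarith
  have hexp : Real.exp (2 * (Real.log (1 + ε ^ 2 / 8) / 2)) = 1 + ε ^ 2 / 8 := by
    rw [mul_div_cancel₀ _ two_ne_zero, Real.exp_log (zero_lt_one.trans hζ)]
  have hθ : 0 < Real.log (1 + ε ^ 2 / 8) / 2 := half_pos (Real.log_pos hζ)
  refine ⟨1 + ε / 2, Real.log (1 + ε ^ 2 / 8) / 2, by linarith, hθ, fun L hL =>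
    ⟨by linarith, by linarith, by linarith, by rw [hexp]; exact hζ.le, by positivity, ?_,
      exp_mul_weight_le hθ hL⟩⟩
  rw [hexp]
  have hs : 0 < 1 + ε / 2 := by linarith
  rw [← Real.le_log_iff_exp_le hs]
  refine le_trans ?_ (Real.one_sub_inv_le_log_of_pos hs)
  rw [← sub_nonneg]
  have : 1 - (1 + ε / 2)⁻¹ - (1 - ε) * ((1 + ε ^ 2 / 8) * (1 + ε / 2) - 1) =
      (1 + ε / 2)⁻¹ * (ε / 2 * (1 - (1 - ε) * (1 + ε / 2)) -
        (1 - ε) * (1 + ε / 2) ^ 2 * (ε ^ 2 / 8)) := by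
    field_simp
    ring
  rw [this]
  refine mul_nonneg (inv_nonneg.2 hs.le) ?_
  have h1 : ε / 2 * (1 - (1 - ε) * (1 + ε / 2)) = ε ^ 2 / 4 * (1 + ε) := by ring
  have h2 : (1 - ε) * (1 + ε / 2) ^ 2 ≤ 2 := by nlinarith [mul_pos hε₀ hε₀]
  have h3 : 0 ≤ ε ^ 2 / 8 := by positivity
  rw [h1]
  nlinarith [mul_le_mul_of_nonneg_right h2 h3]

/-- A component above the truncation is charged `θ` per item and so has at most `c / θ * L` items.
Hence every size is at most a constant times `L` times its weight, and summing brings in the second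
factor `L`. -/
theorem sum_cluster_card_le {ι β : Type*} [Fintype ι] {f : ι × Bool → β} {θ L c : ℝ} (hθ : 0 < θ)
    (hL : 0 < L) (h : ∑ x, weight θ L (cluster f x).card ≤ c * L) :
    ∑ x, ((cluster f x).card : ℝ) ≤ max 1 (c / θ) * (c / θ) * L ^ 2 := by
  set C := max 1 (c / θ) with hC
  have hC1 : 1 ≤ C := le_max_left _ _
  have key : ∀ x, ((cluster f x).card : ℝ) ≤ L * C / θ * weight θ L (cluster f x).card := by
    intro x
    set N : ℝ := ((cluster f x).card : ℝ) with hN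
    have hN0 : 0 ≤ N := Nat.cast_nonneg _
    -- All `N` items of the component contribute the same weight to the total.
    have h1 : N * weight θ L (cluster f x).card ≤ c * L := by
      rw [hN, ← nsmul_eq_mul, ← Finset.sum_const]
      refine le_trans ?_ h
      rw [Finset.sum_congr rfl fun y hy => by rw [← cluster_card_eq hy]]
      exact Finset.sum_le_sum_of_subset_of_nonneg (Finset.subset_univ _)
        fun y _ _ => weight_nonneg hθ.le hL.le _
    have h2 : weight θ L (cluster f x).card = θ * min (N / L) 1 := rfl
    rw [h2] at h1 ⊢
    have h3 : L * C / θ * (θ * min (N / L) 1) = L * C * min (N / L) 1 := by field_simp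
    rw [h3]
    rcases le_total (N / L) 1 with h4 | h4
    · rw [min_eq_left h4, show L * C * (N / L) = C * N by field_simp]
      exact le_mul_of_one_le_left hN0 hC1
    · rw [min_eq_right h4, mul_one] at h1 ⊢
      have h5 : N ≤ c / θ * L := by
        rw [div_mul_eq_mul_div, le_div_iff₀ hθ]
        exact h1
      refine h5.trans ?_
      rw [mul_comm]
      exact mul_le_mul_of_nonneg_left (le_max_right _ _) hL.le
  refine (Finset.sum_le_sum fun x _ => key x).trans ?_
  rw [← Finset.mul_sum]
  have h0 : 0 ≤ L * C / θ := by positivity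
  refine (mul_le_mul_of_nonneg_left h h0).trans_eq ?_
  field_simp

/-- For all but a tiny fraction of the pairs of hash functions, the sum of the squares of the sizes
of the components is linear. -/
theorem exists_card_filter_le {ε : ℝ} (hε₀ : 0 < ε) (hε₁ : ε < 1) : ∃ C c : ℝ, 0 ≤ c ∧
    ∀ (ι : Type u) [Fintype ι] [DecidableEq ι] (m : ℕ), Nonempty ι →
      (Fintype.card ι : ℝ) ≤ (1 - ε) * m → ∀ B : Finset (ι × Bool → Fin m),
      (∀ f ∈ B, C * Fintype.card ι < ∑ x, ((cluster f x).card : ℝ)) →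
      (B.card : ℝ) ≤ Fintype.card (ι × Bool → Fin m) *
        (c * Real.exp (-√(Fintype.card ι))) := by
  obtain ⟨s, θ, hs, hθ, hP⟩ := exists_params hε₀ hε₁
  -- One item costs a factor `1 + a / L`, and all `n = L ^ 2` of them at most `exp (a * L)`.
  -- Markov's inequality at level `(a + 1) * L` then leaves `exp (-L)`.
  set a := 2 / θ * Real.exp (2 * θ) * s ^ 2 with ha
  have hθ2 : 0 < 2 / θ := by positivity
  refine ⟨max 1 ((a + 1) / θ) * ((a + 1) / θ), 1 + 2 / θ, by positivity, ?_⟩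
  intro ι _ _ m hne hm B hB
  set n := Fintype.card ι with hn
  have hn1 : (1 : ℝ) ≤ n := by exact_mod_cast Fintype.card_pos
  set L := √(n : ℝ) with hL
  have hL1 : 1 ≤ L := Real.one_le_sqrt.2 hn1
  have hL0 : 0 < L := zero_lt_one.trans_le hL1
  have hLL : L ^ 2 = n := Real.sq_sqrt (zero_le_one.trans hn1)
  have hlow : ∀ f ∈ B, Real.exp ((a + 1) * L) ≤
      Real.exp (∑ x, weight θ L (cluster f x).card) := by
    intro f hf
    refine Real.exp_le_exp.2 ?_
    by_contra hcon
    have h1 := sum_cluster_card_le hθ hL0 (not_le.1 hcon).le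
    rw [hLL] at h1
    exact absurd (hB f hf) (not_lt.2 h1)
  have hup := sum_exp_cluster_le (ι := ι) (β := Fin m) (hP L hL0) (weight_mono hθ.le hL0.le)
    (by simpa using hm)
  set F : ℝ := ((Fintype.card (ι × Bool → Fin m) : ℕ) : ℝ) with hF
  have hF0 : 0 ≤ F := Nat.cast_nonneg _
  have h1 : B.card * Real.exp ((a + 1) * L) ≤ F *
      ((1 + 2 / θ / L * Real.exp (2 * θ) * s ^ 2) ^ n * (1 + 2 / θ / L)) := by
    rw [← nsmul_eq_mul]
    refine (Finset.card_nsmul_le_sum B _ _ hlow).trans ?_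
    exact (Finset.sum_le_sum_of_subset_of_nonneg (Finset.subset_univ B)
      fun f _ _ => (Real.exp_pos _).le).trans hup
  have h2 : (1 + 2 / θ / L * Real.exp (2 * θ) * s ^ 2) ^ n ≤ Real.exp (a * L) := by
    have h3 : 2 / θ / L * Real.exp (2 * θ) * s ^ 2 = a / L := by rw [ha]; ring
    rw [h3]
    calc (1 + a / L) ^ n ≤ Real.exp (a / L) ^ n := by
          refine pow_le_pow_left₀ (by positivity) ?_ n
          rw [add_comm]
          exact Real.add_one_le_exp _
      _ = Real.exp (a * L) := by
          rw [← Real.exp_nat_mul, ← hLL]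
          congr 1
          field_simp
  have h3 : 1 + 2 / θ / L ≤ 1 + 2 / θ := add_le_add_right (div_le_self hθ2.le hL1) 1
  have h4 : B.card * Real.exp ((a + 1) * L) ≤ F * (Real.exp (a * L) * (1 + 2 / θ)) := by
    refine h1.trans ?_
    gcongr
  have h5 : Real.exp (a * L) = Real.exp ((a + 1) * L) * Real.exp (-L) := by
    rw [← Real.exp_add]
    congr 1
    ring
  rw [h5] at h4
  refine le_of_mul_le_mul_right ?_ (Real.exp_pos ((a + 1) * L))
  linarith

/-! ### Probabilities -/

/-- By independence every pattern of hash values on `X` has the same mass, so counting patterns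
bounds probabilities. -/
theorem RandomHashFunctions.measureReal_hashes_mem_le {𝒳 Ω : Type*} [LinearOrder 𝒳]
    [MeasurableSpace Ω] {P : Measure Ω} [IsProbabilityMeasure P] {m : ℕ} {h₁ h₂ : 𝒳 → Ω → Fin m}
    (h : RandomHashFunctions P h₁ h₂) (X : Finset 𝒳) (B : Finset (X × Bool → Fin m)) :
    P.real {ω | hashes X (fun x => h₁ x ω) (fun x => h₂ x ω) ∈ B} ≤
      B.card * ((m : ℝ)⁻¹) ^ Fintype.card (X × Bool) := by
  set g : X × Bool → 𝒳 ⊕ 𝒳 := fun p => if p.2 then Sum.inr p.1 else Sum.inl p.1 with hg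
  have hg_inj : Function.Injective g := by
    rintro ⟨x, _ | _⟩ ⟨y, _ | _⟩ hxy
    · exact Prod.ext (Subtype.ext (Sum.inl.inj hxy)) rfl
    · exact absurd hxy Sum.inl_ne_inr
    · exact absurd hxy Sum.inr_ne_inl
    · exact Prod.ext (Subtype.ext (Sum.inr.inj hxy)) rfl
  have hind := h.indep.precomp hg_inj
  have hone : ∀ f : X × Bool → Fin m,
      P {ω | hashes X (fun x => h₁ x ω) (fun x => h₂ x ω) = f} =
        ((m : ENNReal)⁻¹) ^ Fintype.card (X × Bool) := by
    intro f
    have h1 := hind.measure_inter_preimage_eq_mul Finset.univ (sets := fun p => {f p})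
      fun p _ => measurableSet_singleton _
    have h2 : ∀ p : X × Bool, P (Sum.elim h₁ h₂ (g p) ⁻¹' {f p}) = (m : ENNReal)⁻¹ := by
      rintro ⟨x, _ | _⟩
      · exact h.uniform₁ x _
      · exact h.uniform₂ x _
    rw [Finset.prod_congr rfl fun p _ => h2 p, Finset.prod_const, Finset.card_univ] at h1
    rw [← h1]
    congr 1
    ext ω
    simp only [Set.mem_ofPred_eq, funext_iff, Set.mem_iInter, Finset.mem_univ, Set.mem_preimage,
      Set.mem_singleton_iff, forall_true_left]
    refine forall_congr' ?_
    rintro ⟨x, _ | _⟩ <;> rfl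
  have hset : {ω | hashes X (fun x => h₁ x ω) (fun x => h₂ x ω) ∈ B} =
      ⋃ f ∈ B, {ω | hashes X (fun x => h₁ x ω) (fun x => h₂ x ω) = f} := by
    ext ω
    simp
  rw [hset]
  refine (measureReal_biUnion_finset_le _ _).trans ?_
  rw [Finset.sum_congr rfl fun f _ => by rw [measureReal_def, hone f], Finset.sum_const,
    nsmul_eq_mul]
  simp

/-- A single term of the exponential series at `√n` suffices; degree `⌈2 * α⌉₊` makes up for the
square root. -/
theorem exp_neg_sqrt_le (α : ℝ) {n : ℕ} (hn : 1 ≤ n) :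
    Real.exp (-√(n : ℝ)) ≤ (⌈2 * α⌉₊.factorial : ℝ) * (n : ℝ) ^ (-α) := by
  set j := ⌈2 * α⌉₊ with hj
  have hn1 : (1 : ℝ) ≤ n := by exact_mod_cast hn
  have hn0 : (0 : ℝ) < n := zero_lt_one.trans_le hn1
  have h1 : (n : ℝ) ^ α ≤ √(n : ℝ) ^ j := by
    rw [Real.sqrt_eq_rpow, ← Real.rpow_natCast, ← Real.rpow_mul hn0.le]
    refine Real.rpow_le_rpow_of_exponent_le hn1 ?_
    have := Nat.le_ceil (2 * α)
    rw [← hj] at this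
    linarith
  have h2 := Real.pow_div_factorial_le_exp (√(n : ℝ)) (Real.sqrt_nonneg _) j
  rw [div_le_iff₀ (by positivity)] at h2
  rw [Real.exp_neg, Real.rpow_neg hn0.le, ← div_eq_mul_inv, le_div_iff₀ (Real.rpow_pos_of_pos hn0 α),
    inv_mul_le_iff₀ (Real.exp_pos _)]
  exact h1.trans h2

end CuckooBFS

/-! ### The theorem. -/

theorem mainTheorem6 (ε : ℝ) (hε₀ : 0 < ε) (hε₁ : ε < 1) :
    ∃ C : ℕ, ∀ α : ℝ, 0 < α → ∃ K : ℝ,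
      ∀ (𝒳 : Type u) [LinearOrder 𝒳] (Ω : Type v) [MeasurableSpace Ω]
        (P : Measure Ω) [IsProbabilityMeasure P] (m : ℕ) (h₁ h₂ : 𝒳 → Ω → Fin m)
        (X : Finset 𝒳),
        CuckooBFS.RandomHashFunctions P h₁ h₂ →
        (X.card : ℝ) ≤ (1 - ε) * m →
        P.real {ω | ((C * X.card : ℕ) : ℕ∞) <
            CuckooBFS.messageComplexity X (fun x => h₁ x ω) (fun x => h₂ x ω)}
          ≤ K * (X.card : ℝ) ^ (-α) := by
  classical
  obtain ⟨C, c, hc, H⟩ := CuckooBFS.exists_card_filter_le.{u} hε₀ hε₁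
  refine ⟨⌈230 * C⌉₊, fun α _ => ⟨c * (⌈2 * α⌉₊.factorial : ℝ), ?_⟩⟩
  intro 𝒳 _ Ω _ P _ m h₁ h₂ X hh hm
  set B : Finset (X × Bool → Fin m) := Finset.univ.filter fun f =>
    C * X.card < ∑ x, ((CuckooBFS.cluster f x).card : ℝ) with hB
  have hsub : {ω | ((⌈230 * C⌉₊ * X.card : ℕ) : ℕ∞) <
      CuckooBFS.messageComplexity X (fun x => h₁ x ω) (fun x => h₂ x ω)} ⊆
      {ω | CuckooBFS.hashes X (fun x => h₁ x ω) (fun x => h₂ x ω) ∈ B} := by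
    intro ω hω
    have h1 := lt_of_lt_of_le (Set.mem_ofPred_eq ▸ hω) (CuckooBFS.messageComplexity_le X
      (fun x => h₁ x ω) (fun x => h₂ x ω))
    rw [Nat.cast_lt] at h1
    simp only [Set.mem_ofPred_eq, hB, Finset.mem_filter, Finset.mem_univ, true_and]
    have h2 : ((⌈230 * C⌉₊ * X.card : ℕ) : ℝ) < ((230 * ∑ x, (CuckooBFS.cluster
        (CuckooBFS.hashes X (fun x => h₁ x ω) (fun x => h₂ x ω)) x).card : ℕ) : ℝ) :=
      Nat.cast_lt.2 h1
    push_cast at h2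
    have h3 := mul_le_mul_of_nonneg_right (Nat.le_ceil (230 * C))
      (Nat.cast_nonneg (α := ℝ) X.card)
    linarith
  -- Without items the defining inequality of `B` reads `0 < 0`.
  rcases X.eq_empty_or_nonempty with rfl | hX
  · have hBe : B = ∅ := by
      rw [hB]
      simp
    rw [hBe] at hsub
    simp only [Finset.notMem_empty, Set.ofPred_false, Set.subset_empty_iff] at hsub
    rw [hsub, measureReal_empty]
    positivity
  have hX1 : 1 ≤ X.card := Finset.card_pos.2 hX
  -- Needed to cancel the number of hash patterns against their common mass.
  have hm0 : (0 : ℝ) < m := by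
    have : (1 : ℝ) ≤ X.card := by exact_mod_cast hX1
    by_contra hcon
    have h0 : (m : ℝ) = 0 := le_antisymm (not_lt.1 hcon) (Nat.cast_nonneg m)
    rw [h0, mul_zero] at hm
    linarith
  have hcard : (B.card : ℝ) ≤ Fintype.card (X × Bool → Fin m) *
      (c * Real.exp (-√(X.card : ℝ))) := by
    have := H X m hX.to_subtype (by simpa using hm) B fun f hf => by
      simpa using (Finset.mem_filter.1 hf).2
    simpa only [Fintype.card_coe] using this
  calc P.real {ω | ((⌈230 * C⌉₊ * X.card : ℕ) : ℕ∞) <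
        CuckooBFS.messageComplexity X (fun x => h₁ x ω) (fun x => h₂ x ω)}
      ≤ P.real {ω | CuckooBFS.hashes X (fun x => h₁ x ω) (fun x => h₂ x ω) ∈ B} :=
        measureReal_mono hsub
    _ ≤ B.card * ((m : ℝ)⁻¹) ^ Fintype.card (X × Bool) := hh.measureReal_hashes_mem_le X B
    _ ≤ Fintype.card (X × Bool → Fin m) * (c * Real.exp (-√(X.card : ℝ))) *
        ((m : ℝ)⁻¹) ^ Fintype.card (X × Bool) := by gcongr
    _ = c * Real.exp (-√(X.card : ℝ)) := by
        rw [Fintype.card_fun, Fintype.card_fin, Nat.cast_pow, inv_pow]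
        field_simp
    _ ≤ c * ((⌈2 * α⌉₊.factorial : ℝ) * (X.card : ℝ) ^ (-α)) := by
        gcongr
        exact CuckooBFS.exp_neg_sqrt_le α hX1
    _ = c * (⌈2 * α⌉₊.factorial : ℝ) * (X.card : ℝ) ^ (-α) := by ring
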